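/- Let $\mathbb K$ be an algebraically closed field of arbitrary characteristic, let $q_1,q_2\in\mathbb K\setminus\{0,1\}$ and $\lambda\in\mathbb K^*$ be primitive $l_1$-th, $l_2$-th and $l_3$-th roots of unity respectively ($l_1,l_2,l_3\ge 1$), and let $A=A(q_1,q_2,\lambda)$ be the second quantum Weyl algebra, i.e. the associative unital $\mathbb K$-algebra generated by $x_1,y_1,x_2,y_2$ with relations $$x_1x_2=q_1\lambda x_2x_1,\quad x_1y_2=\lambda^{-1}y_2x_1,\quad y_1y_2=\lambda y_2y_1,\quad y_1x_2=q_1^{-1}\lambda^{-1}x_2y_1,$$ $$x_1y_1-q_1y_1x_1=1,\qquad x_2y_2-q_2y_2x_2=1+(q_1-1)y_1x_1.$$ Put $z_1=x_1y_1-y_1x_1$. Let $\mathcal O_\Lambda(\mathbb K^4)$ be the quantum affine space on generators $x_1,y_1,x_2,y_2$ (in this order, denoted $u_1,\dots,u_4$) with relations $u_iu_j=\Lambda_{ij}u_ju_i$, where $$\Lambda=\begin{pmatrix}1&1&q_1\lambda&\lambda^{-1}\\1&1&q_1^{-1}\lambda^{-1}&\lambda\\q_1^{-1}\lambda^{-1}&q_1\lambda&1&q_2\\\lambda&\lambda^{-1}&q_2^{-1}&1\end{pmatrix},$$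 and let $B=\mathcal O_\Lambda(\mathbb K^4)/\langle 1+(q_1-1)y_1x_1\rangle$ be the quotient by the two-sided ideal generated by $1+(q_1-1)y_1x_1$. All modules are right modules. Then: (a) There is a $\mathbb K$-algebra isomorphism $\varphi:A/\langle z_1\rangle\to B$ sending the class of each generator $x_1,y_1,x_2,y_2$ to the class of the generator with the same name. Through the resulting homomorphism $\pi:A\to A/\langle z_1\rangle\to B$, the simple $A$-modules on which $z_1$ acts as zero are exactly the simple $B$-modules on which $x_1$ and $y_1$ act invertibly: every simple $A$-module $M$ with $Mz_1=0$ carries a unique $B$-module structure (compatible with its $\mathbb K$-vector space structure) such that $v\,\pi(a)=v\,a$ for all $v\in M$, $a\in A$, under which $M$ is simple and $x_1,y_1$ act invertibly; conversely, every simple $B$-module on which $x_1,y_1$ act invertibly carries a unique $A$-module structure (compatible with its $\mathbb K$-vector space structure) such that $v\,a=v\,\pi(a)$, under which it is simple with $z_1$ acting as zero. (b) Let $M$ be a simple $A$-module on which $z_1$ acts as zero. Then $M$ is finite-dimensional over $\mathbb K$, each of $x_2$ and $y_2$ acts on $M$ either invertibly or nilpotently, and 1. if $x_2$ and $y_2$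 both act invertibly, then $\dim_{\mathbb K}M=\operatorname{lcm}(l_1,l_2,l_3)$; 2. if $x_2$ acts invertibly and $y_2$ nilpotently, then $\dim_{\mathbb K}M=\operatorname{ord}(q_1\lambda)$; 3. if $x_2$ acts nilpotently and $y_2$ invertibly, then $\dim_{\mathbb K}M=\operatorname{ord}(\lambda)$; 4. if $x_2$ and $y_2$ both act nilpotently, then $\dim_{\mathbb K}M=1$. -/

import Mathlib

open MulOpposite

/-- The defining relations of the second quantum Weyl algebra, on the free algebra with
generators `x₁, y₁, x₂, y₂` indexed by `0, 1, 2, 3` in this order. -/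
inductive QWeylRel {K : Type*} [Field K] (q₁ q₂ lam : K) :
    FreeAlgebra K (Fin 4) → FreeAlgebra K (Fin 4) → Prop
  | x₁x₂ : QWeylRel q₁ q₂ lam
      (FreeAlgebra.ι K 0 * FreeAlgebra.ι K 2)
      ((q₁ * lam) • (FreeAlgebra.ι K 2 * FreeAlgebra.ι K 0))
  | x₁y₂ : QWeylRel q₁ q₂ lam
      (FreeAlgebra.ι K 0 * FreeAlgebra.ι K 3)
      (lam⁻¹ • (FreeAlgebra.ι K 3 * FreeAlgebra.ι K 0))
  | y₁y₂ : QWeylRel q₁ q₂ lam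
      (FreeAlgebra.ι K 1 * FreeAlgebra.ι K 3)
      (lam • (FreeAlgebra.ι K 3 * FreeAlgebra.ι K 1))
  | y₁x₂ : QWeylRel q₁ q₂ lam
      (FreeAlgebra.ι K 1 * FreeAlgebra.ι K 2)
      ((q₁⁻¹ * lam⁻¹) • (FreeAlgebra.ι K 2 * FreeAlgebra.ι K 1))
  | x₁y₁ : QWeylRel q₁ q₂ lam
      (FreeAlgebra.ι K 0 * FreeAlgebra.ι K 1 - q₁ • (FreeAlgebra.ι K 1 * FreeAlgebra.ι K 0))
      1
  | x₂y₂ : QWeylRel q₁ q₂ lam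
      (FreeAlgebra.ι K 2 * FreeAlgebra.ι K 3 - q₂ • (FreeAlgebra.ι K 3 * FreeAlgebra.ι K 2))
      (1 + (q₁ - 1) • (FreeAlgebra.ι K 1 * FreeAlgebra.ι K 0))

/-- The second quantum Weyl algebra `A(q₁, q₂, λ)`. -/
abbrev QWeyl {K : Type*} [Field K] (q₁ q₂ lam : K) : Type _ :=
  RingQuot (QWeylRel q₁ q₂ lam)

/-- The generators `x₁, y₁, x₂, y₂` of `A(q₁, q₂, λ)`, indexed by `0, 1, 2, 3`. -/
def QWeyl.gen {K : Type*} [Field K] (q₁ q₂ lam : K) (i : Fin 4) : QWeyl q₁ q₂ lam :=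
  RingQuot.mkAlgHom K (QWeylRel q₁ q₂ lam) (FreeAlgebra.ι K i)

/-- The element `z₁ = x₁ y₁ - y₁ x₁` of `A(q₁, q₂, λ)`. -/
def QWeyl.z₁ {K : Type*} [Field K] (q₁ q₂ lam : K) : QWeyl q₁ q₂ lam :=
  QWeyl.gen q₁ q₂ lam 0 * QWeyl.gen q₁ q₂ lam 1 - QWeyl.gen q₁ q₂ lam 1 * QWeyl.gen q₁ q₂ lam 0

/-- The defining relations `X_i X_j = Λ_{ij} X_j X_i` of quantum affine space. -/
inductive QAffineRel {K : Type*} [Field K] {n : ℕ} (L : Matrix (Fin n) (Fin n) K) :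
    FreeAlgebra K (Fin n) → FreeAlgebra K (Fin n) → Prop
  | comm (i j : Fin n) : QAffineRel L
      (FreeAlgebra.ι K i * FreeAlgebra.ι K j)
      (L i j • (FreeAlgebra.ι K j * FreeAlgebra.ι K i))

/-- The quantum affine `n`-space `O_Λ(Kⁿ)`. -/
abbrev QAffine {K : Type*} [Field K] {n : ℕ} (L : Matrix (Fin n) (Fin n) K) : Type _ :=
  RingQuot (QAffineRel L)

/-- The generators of `O_Λ(Kⁿ)`. -/
def QAffine.gen {K : Type*} [Field K] {n : ℕ} (L : Matrix (Fin n) (Fin n) K) (i : Fin n) :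
    QAffine L :=
  RingQuot.mkAlgHom K (QAffineRel L) (FreeAlgebra.ι K i)

/-- The quotient `R / ⟨a⟩` of a ring by the two-sided ideal generated by `a`. -/
abbrev QuotByElem {R : Type*} [Ring R] (a : R) : Type _ :=
  RingQuot (fun r s : R => r = a ∧ s = 0)

/-- The canonical map `R → R / ⟨a⟩`, for a `K`-algebra `R`. -/
def toQuot (K : Type*) [Field K] {R : Type*} [Ring R] [Algebra K R] (a : R) :
    R →ₐ[K] QuotByElem a :=
  RingQuot.mkAlgHom K (fun r s : R => r = a ∧ s = 0)

/-- The multiplicatively antisymmetric matrix `Λ`, for the ordering `x₁, y₁, x₂, y₂`. -/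
def typeIIIMatrix {K : Type*} [Field K] (q₁ q₂ lam : K) : Matrix (Fin 4) (Fin 4) K :=
  !![1, 1, q₁ * lam, lam⁻¹;
     1, 1, q₁⁻¹ * lam⁻¹, lam;
     q₁⁻¹ * lam⁻¹, q₁ * lam, 1, q₂;
     lam, lam⁻¹, q₂⁻¹, 1]

/-- The element `1 + (q₁ - 1) y₁ x₁` of `O_Λ(K⁴)`. -/
def typeIIIElem {K : Type*} [Field K] (q₁ q₂ lam : K) : QAffine (typeIIIMatrix q₁ q₂ lam) :=
  1 + (q₁ - 1) • (QAffine.gen (typeIIIMatrix q₁ q₂ lam) 1 *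
    QAffine.gen (typeIIIMatrix q₁ q₂ lam) 0)

/-- The algebra `O_Λ(K⁴) / ⟨1 + (q₁ - 1) y₁ x₁⟩`. -/
abbrev TypeIIIQuot {K : Type*} [Field K] (q₁ q₂ lam : K) : Type _ :=
  QuotByElem (typeIIIElem q₁ q₂ lam)

/-- The images of `x₁, y₁, x₂, y₂` in `O_Λ(K⁴) / ⟨1 + (q₁ - 1) y₁ x₁⟩`, indexed by
`0, 1, 2, 3`. -/
def TypeIIIQuot.gen {K : Type*} [Field K] (q₁ q₂ lam : K) (i : Fin 4) :
    TypeIIIQuot q₁ q₂ lam :=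
  toQuot K (typeIIIElem q₁ q₂ lam) (QAffine.gen (typeIIIMatrix q₁ q₂ lam) i)

/-!
Right `R`-modules are modules over `Rᵐᵒᵖ`, with `v a = op a • v`.
-/

/-- The element `a` acts as zero on the right `R`-module `M`. -/
def ActsAsZero {R : Type*} [Ring R] (M : Type*) [AddCommGroup M] [Module Rᵐᵒᵖ M] (a : R) : Prop :=
  ∀ v : M, op a • v = 0

/-- The element `a` acts as an invertible operator on the right `R`-module `M`. -/
def ActsInvertibly {R : Type*} [Ring R] (M : Type*) [AddCommGroup M] [Module Rᵐᵒᵖ M] (a : R) :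
    Prop :=
  Function.Bijective fun v : M => op a • v

/-- The element `a` acts as a nilpotent operator on the right `R`-module `M`. -/
def ActsNilpotently {R : Type*} [Ring R] (M : Type*) [AddCommGroup M] [Module Rᵐᵒᵖ M] (a : R) :
    Prop :=
  ∃ n : ℕ, ∀ v : M, op (a ^ n) • v = 0

/-! Modulo `z₁` the generators `x₁, y₁` commute, so `x₁ y₁ - q₁ y₁ x₁ = 1` turns into `(1 - q₁) y₁
x₁ = 1`. This is the relation `1 + (q₁ - 1) y₁ x₁ = 0` of `B`, and it reduces the last relation of
`A` to `x₂ y₂ = q₂ y₂ x₂`. Hence `A / ⟨z₁⟩` and `B` have the same presentation. In `B` the elements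
`x₁` and `y₁` are inverse to each other up to a nonzero scalar, and simple modules pass along the
surjection `A → B` in both directions.

For the dimensions, let `n = l₁ l₂ l₃`. The `n`-th powers of the generators act by operators
commuting with the whole action, and `M` is finitely generated over the commutative algebra `C` they
generate. A maximal ideal `I` of `C` annihilates `M`, and `C / I` is finite over `K` by the
Nullstellensatz, so `M` is finite-dimensional (`finiteDimensional_of_irreducible_of_qcomm`). Up to
scalars `x₂` and `y₂` commute with all generators, so each acts as zero or bijectively
(`IrreducibleUnder.eq_zero_or_bijective`), and nilpotent means zero.

Since `y₁` is a multiple of `x₁⁻¹`, what remains is an irreducible family of one, two or three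
invertible operators commuting up to roots of unity. For a pair with scalar `ζ`, the second operator
permutes the eigenlines of the first cyclically, and the dimension is the order of `ζ`
(`finrank_eq_orderOf_of_qcomm`). For a triple, two unimodular changes of generators make one
operator commute with the other two. It is then a scalar by Schur's lemma, which leaves a pair whose
scalar has order the lcm of the three original orders (`finrank_eq_lcm_of_twistedComm`). -/

/-! ### `q`-commuting elements -/

/-- If `x y = a y x`, then `x yⁿ = aⁿ yⁿ x`. -/
theorem qcomm_pow_right {K R : Type*} [Field K] [Ring R] [Algebra K R] {a : K} {x y : R}
    (h : x * y = a • (y * x)) (n : ℕ) : x * y ^ n = a ^ n • (y ^ n * x) := by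
  induction n with
  | zero => simp
  | succ n ih =>
    rw [pow_succ, ← mul_assoc, ih, smul_mul_assoc, mul_assoc, h, mul_smul_comm, smul_smul,
      ← mul_assoc, pow_succ]

/-- If `x y = a y x`, then `xⁿ y = aⁿ y xⁿ`. -/
theorem qcomm_pow_left {K R : Type*} [Field K] [Ring R] [Algebra K R] {a : K} {x y : R}
    (h : x * y = a • (y * x)) (n : ℕ) : x ^ n * y = a ^ n • (y * x ^ n) := by
  induction n with
  | zero => simp
  | succ n ih =>
    rw [pow_succ, mul_assoc, h, mul_smul_comm, ← mul_assoc, ih, smul_mul_assoc, smul_smul,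
      mul_assoc, pow_succ' a]

/-! ### Irreducible sets of operators -/

section Irreducible

variable {K M : Type*} [Field K] [AddCommGroup M] [Module K M]

/-- A set of operators on `M` is irreducible if its only invariant subspaces are `0` and `M`. -/
def IrreducibleUnder (S : Set (Module.End K M)) : Prop :=
  ∀ W : Submodule K M, (∀ f ∈ S, ∀ w ∈ W, f w ∈ W) → W = ⊥ ∨ W = ⊤

/-- Schur's lemma. -/
theorem IrreducibleUnder.exists_eq_smul [IsAlgClosed K] [FiniteDimensional K M] [Nontrivial M]
    {S : Set (Module.End K M)} (hS : IrreducibleUnder S) (T : Module.End K M)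
    (hT : ∀ f ∈ S, f * T = T * f) : ∃ c : K, ∀ m, T m = c • m := by
  obtain ⟨c, hc⟩ := Module.End.exists_eigenvalue T
  refine ⟨c, fun m => ?_⟩
  have h := hS (T.eigenspace c) fun f hf w hw => by
    rw [Module.End.mem_eigenspace_iff] at hw ⊢
    have := LinearMap.congr_fun (hT f hf) w
    simp only [Module.End.mul_apply] at this
    rw [← this, hw, map_smul]
  rcases h with h | h
  · exact absurd h hc
  · exact Module.End.mem_eigenspace_iff.1 (h ▸ Submodule.mem_top)

/-- An irreducible pair of injective `ζ`-commuting operators, where `ζ` has finite order, acts on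
a space of dimension the order of `ζ`. -/
theorem finrank_eq_orderOf_of_qcomm [IsAlgClosed K] [FiniteDimensional K M] [Nontrivial M]
    {U V : Module.End K M} {ζ : K} (hζ : 0 < orderOf ζ) (hUV : U * V = ζ • (V * U))
    (hU : Function.Injective U) (hV : Function.Injective V) (hirr : IrreducibleUnder {U, V}) :
    Module.finrank K M = orderOf ζ := by
  set n := orderOf ζ with hn
  obtain ⟨μ, hμ⟩ := Module.End.exists_eigenvalue U
  obtain ⟨v, hv⟩ := hμ.exists_hasEigenvector
  have hv0 : v ≠ 0 := hv.2
  have hμ0 : μ ≠ 0 := by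
    rintro rfl
    have := hv.apply_eq_smul
    rw [zero_smul] at this
    exact hv0 (hU (by rw [this, map_zero]))
  have hVi : ∀ i : ℕ, (V ^ i) v ≠ 0 := fun i h => by
    have : Function.Injective (V ^ i) := by
      rw [Module.End.coe_pow]; exact hV.iterate i
    exact hv0 (this (by rw [h, map_zero]))
  have hUi : ∀ i : ℕ, U ((V ^ i) v) = (ζ ^ i * μ) • (V ^ i) v := fun i => by
    have := LinearMap.congr_fun (qcomm_pow_right hUV i) v
    simp only [Module.End.mul_apply, LinearMap.smul_apply] at this
    rw [this, hv.apply_eq_smul, map_smul, smul_smul]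
  -- The eigenvalues `ζ ^ i * μ` with `i < n` are distinct because `μ ≠ 0` and `ζ` has order `n`.
  have hli : LinearIndependent K fun i : Fin n => (V ^ (i : ℕ)) v := by
    refine Module.End.eigenvectors_linearIndependent' U (fun i : Fin n => ζ ^ (i : ℕ) * μ) ?_ _
      fun i => ⟨Module.End.mem_eigenspace_iff.2 (hUi i), hVi i⟩
    intro i j hij
    have := mul_right_cancel₀ hμ0 hij
    exact Fin.ext (pow_injOn_Iio_orderOf i.2 j.2 this)
  -- `ζ ^ n = 1` makes `V ^ n` commute with `U` as well as `V`. Being a scalar, it closes the chain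
  -- `v, V v, ..., V ^ (n - 1) v` into a cycle, so the span is invariant.
  obtain ⟨c, hc⟩ := hirr.exists_eq_smul (V ^ n) (by
    rintro f (rfl | rfl)
    · rw [qcomm_pow_right hUV n, hn, pow_orderOf_eq_one, one_smul]
    · exact (Commute.self_pow _ n).eq)
  have htop : Submodule.span K (Set.range fun i : Fin n => (V ^ (i : ℕ)) v) = ⊤ := by
    refine (hirr _ ?_).resolve_left fun h => ?_
    · intro f hf w hw
      induction hw using Submodule.span_induction with
      | zero => rw [map_zero]; exact zero_mem _
      | add x y _ _ hx hy => rw [map_add]; exact add_mem hx hy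
      | smul a x _ hx => rw [map_smul]; exact Submodule.smul_mem _ _ hx
      | mem x hx =>
        obtain ⟨i, rfl⟩ := hx
        rcases hf with rfl | rfl
        · dsimp only
          rw [hUi]
          exact Submodule.smul_mem _ _ (Submodule.subset_span ⟨i, rfl⟩)
        · dsimp only
          rw [← Module.End.mul_apply, ← pow_succ']
          rcases Nat.lt_or_ge (i + 1) n with hi | hi
          · exact Submodule.subset_span ⟨⟨i + 1, hi⟩, rfl⟩
          · rw [show (i : ℕ) + 1 = n by omega, hc]
            exact Submodule.smul_mem _ _ (Submodule.subset_span ⟨⟨0, hζ⟩, by simp⟩)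
    · refine hVi 0 ?_
      rw [← Submodule.mem_bot K, ← h]
      exact Submodule.subset_span ⟨⟨0, hζ⟩, rfl⟩
  rw [← finrank_top K M, ← htop, finrank_span_eq_card hli, Fintype.card_fin]

/-- A space on which a single injective operator is irreducible is one-dimensional. -/
theorem finrank_eq_one_of_irreducible_singleton [IsAlgClosed K] [FiniteDimensional K M]
    [Nontrivial M] {U : Module.End K M} (hirr : IrreducibleUnder {U})
    (hU : Function.Injective U) : Module.finrank K M = 1 := by
  rw [← orderOf_one (G := K)]
  -- The identity serves as second operator of a pair with `ζ = 1`.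
  refine finrank_eq_orderOf_of_qcomm (U := U) (V := 1) (by simp) (by simp) hU (fun _ _ h => h) ?_
  intro W hW
  exact hirr W fun f hf => hW f (Or.inl hf)

/-! ### Triples of invertible operators -/

/-- The units of `End M` that preserve a given subspace of a finite-dimensional space `M`. -/
def unitsStabilizer [FiniteDimensional K M] (W : Submodule K M) :
    Subgroup (Module.End K M)ˣ where
  carrier := {g | ∀ w ∈ W, (g : Module.End K M) w ∈ W}
  mul_mem' := fun hg hh w hw => hg _ (hh w hw)
  one_mem' := fun w hw => hw
  inv_mem' := by
    intro g hg w hw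
    -- In finite dimension an injective endomorphism of `W` is onto, so `g W ⊆ W` forces `g⁻¹ W ⊆
    -- W`.
    have hinj : Function.Injective ((g : Module.End K M).restrict hg) := by
      intro x y hxy
      have h1 : (g : Module.End K M) x = (g : Module.End K M) y := congrArg Subtype.val hxy
      have h2 := congrArg ((g⁻¹ : (Module.End K M)ˣ) : Module.End K M) h1
      rw [← Module.End.mul_apply, ← Module.End.mul_apply, Units.inv_mul] at h2
      exact Subtype.ext h2
    obtain ⟨u, hu⟩ := LinearMap.injective_iff_surjective.1 hinj ⟨w, hw⟩
    have hu' : (g : Module.End K M) u = w := congrArg Subtype.val hu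
    rw [← hu', ← Module.End.mul_apply, Units.inv_mul]
    exact u.2

/-- The invertible scalar operators on `M`. -/
def scalarUnits (K M : Type*) [Field K] [AddCommGroup M] [Module K M] :
    Kˣ →* (Module.End K M)ˣ :=
  Units.map (algebraMap K (Module.End K M)).toMonoidHom

theorem scalarUnits_central (a : Kˣ) (g : (Module.End K M)ˣ) :
    Commute (scalarUnits K M a) g :=
  Units.ext (Algebra.commutes (a : K) (g : Module.End K M))

theorem scalarUnits_mem_unitsStabilizer [FiniteDimensional K M] (a : Kˣ) (W : Submodule K M) :
    scalarUnits K M a ∈ unitsStabilizer W := fun _ hw => W.smul_mem _ hw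

end Irreducible

/-! ### Commutation up to central scalars in a group -/

section Twisted

variable {A G : Type*} [CommGroup A] [Group G] {c : A →* G}

/-- The elements `x` and `y` commute up to the scalar `a`. -/
def TwistedComm (c : A →* G) (x y : G) (a : A) : Prop := x * y = c a * (y * x)

theorem TwistedComm.symm {x y : G} {a : A}
    (h : TwistedComm c x y a) : TwistedComm c y x a⁻¹ := by
  unfold TwistedComm at *
  rw [h, ← mul_assoc, ← map_mul, inv_mul_cancel, map_one, one_mul]

theorem TwistedComm.mul_right (hc : ∀ a g, Commute (c a) g) {x y z : G} {a b : A}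
    (h : TwistedComm c x y a) (h' : TwistedComm c x z b) : TwistedComm c x (y * z) (a * b) := by
  unfold TwistedComm at *
  rw [← mul_assoc, h, mul_assoc, mul_assoc, h', ← mul_assoc y, ← (hc b y).eq, map_mul]
  simp only [mul_assoc]

theorem TwistedComm.inv_right (hc : ∀ a g, Commute (c a) g) {x y : G} {a : A}
    (h : TwistedComm c x y a) : TwistedComm c x y⁻¹ a⁻¹ := by
  unfold TwistedComm at *
  have h2 : y⁻¹ * x = c a * (x * y⁻¹) := by
    rw [inv_mul_eq_iff_eq_mul, ← mul_assoc, ← (hc a y).eq, mul_assoc, ← mul_assoc y, ← mul_assoc,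
      ← h, mul_inv_cancel_right]
  rw [h2, ← mul_assoc, ← map_mul, inv_mul_cancel, map_one, one_mul]

theorem TwistedComm.zpow_right (hc : ∀ a g, Commute (c a) g) {x y : G} {a : A}
    (h : TwistedComm c x y a) (n : ℤ) : TwistedComm c x (y ^ n) (a ^ n) := by
  induction n with
  | zero => simp [TwistedComm]
  | succ n ih => rw [zpow_add_one, zpow_add_one]; exact ih.mul_right hc h
  | pred n ih => rw [zpow_sub_one, zpow_sub_one]; exact ih.mul_right hc (h.inv_right hc)

theorem TwistedComm.self (x : G) : TwistedComm c x x 1 := by simp [TwistedComm]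

/-- A monomial in `y, z` twisted-commutes with an element that does so with `y` and `z`. -/
theorem TwistedComm.monomial_right (hc : ∀ a g, Commute (c a) g) {x y z : G} {a b : A}
    (h : TwistedComm c x y a) (h' : TwistedComm c x z b) (m n : ℤ) :
    TwistedComm c x (y ^ m * z ^ n) (a ^ m * b ^ n) :=
  (h.zpow_right hc m).mul_right hc (h'.zpow_right hc n)

/-- Unimodular changes of generators preserve the commutation scalar. -/
theorem TwistedComm.unimodular (hc : ∀ a g, Commute (c a) g) {y z : G} {a : A}
    (h : TwistedComm c y z a) {p q r s : ℤ} (hdet : p * s - q * r = 1) :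
    TwistedComm c (y ^ p * z ^ q) (y ^ r * z ^ s) a := by
  -- The commutation scalar is multiplicative in each argument and trivial on the diagonal, so it
  -- comes out as `a` to the power of the determinant `p * s - q * r`.
  have hz := (TwistedComm.monomial_right hc (h.symm) (TwistedComm.self z) p q).symm
  have hy := (TwistedComm.monomial_right hc (TwistedComm.self y) h p q).symm
  have := TwistedComm.monomial_right hc hy hz r s
  convert this using 1
  simp only [one_zpow, mul_one, one_mul, inv_zpow', zpow_neg, inv_inv]
  rw [← zpow_neg, ← zpow_mul, ← zpow_mul, ← zpow_add,
    show q * -r + p * s = 1 by linarith, zpow_one]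

/-- The old generators are monomials in the new ones, up to scalars. -/
theorem TwistedComm.mem_of_unimodular (hc : ∀ a g, Commute (c a) g) {y z : G} {a : A}
    (h : TwistedComm c y z a) {p q r s : ℤ} (hdet : p * s - q * r = 1) (H : Subgroup G)
    (hcH : ∀ a, c a ∈ H) (h₁ : y ^ p * z ^ q ∈ H) (h₂ : y ^ r * z ^ s ∈ H) :
    y ∈ H ∧ z ∈ H := by
  -- Modulo the central subgroup of scalars `y` and `z` commute, so monomials multiply by adding
  -- exponents and the inverse integer matrix recovers `y` and `z`.
  set N : Subgroup G := c.range with hN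
  have hNn : N.Normal := ⟨by
    rintro _ ⟨b, rfl⟩ g
    exact ⟨b, by rw [← (hc b g).eq, mul_inv_cancel_right]⟩⟩
  have key : ∀ g : G, ∀ g' ∈ H, (g : G ⧸ N) = g' → g ∈ H := by
    intro g g' hg' e
    obtain ⟨b, hb⟩ := QuotientGroup.eq.1 e.symm
    have : g = g' * c b := by rw [hb]; group
    rw [this]; exact H.mul_mem hg' (hcH b)
  have hcomm : Commute (y : G ⧸ N) z := by
    have : ((c a : G) : G ⧸ N) = 1 := (QuotientGroup.eq_one_iff _).2 ⟨a, rfl⟩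
    have h' := congrArg (QuotientGroup.mk' N) h
    simp only [QuotientGroup.mk'_apply, QuotientGroup.mk_mul, this, one_mul] at h'
    exact h'
  have e : ∀ i j : ℤ, ((((y ^ p * z ^ q) ^ i * (y ^ r * z ^ s) ^ j : G)) : G ⧸ N) =
      (y : G ⧸ N) ^ (p * i + r * j) * (z : G ⧸ N) ^ (q * i + s * j) := by
    intro i j
    simp only [QuotientGroup.mk_mul, QuotientGroup.mk_zpow]
    rw [((hcomm.zpow_zpow p q)).mul_zpow, ((hcomm.zpow_zpow r s)).mul_zpow, ← zpow_mul,
      ← zpow_mul, ← zpow_mul, ← zpow_mul, zpow_add, zpow_add]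
    rw [mul_assoc, ← mul_assoc ((z : G ⧸ N) ^ (q * i)), (hcomm.symm.zpow_zpow (q * i) (r * j)).eq]
    simp only [mul_assoc]
  constructor
  · refine key y _ (H.mul_mem (H.zpow_mem h₁ s) (H.zpow_mem h₂ (-q))) ?_
    rw [e, show p * s + r * -q = 1 by linarith, show q * s + s * -q = 0 by ring]
    simp
  · refine key z _ (H.mul_mem (H.zpow_mem h₁ (-r)) (H.zpow_mem h₂ p)) ?_
    rw [e, show p * -r + r * p = 0 by ring, show q * -r + s * p = 1 by linarith]
    simp

end Twisted

/-! ### Dimension of irreducible representations of a quantum torus in three variables -/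

/-- For roots of unity `a, b` there is a unimodular integer matrix with rows `(p, q)`, `(r, s)`
such that `aʳ bˢ = 1`. -/
theorem exists_unimodular_zpow_mul_zpow_eq_one {K : Type*} [Field K] {a b : Kˣ}
    (ha : IsOfFinOrder a) (hb : IsOfFinOrder b) :
    ∃ p q r s : ℤ, p * s - q * r = 1 ∧ a ^ r * b ^ s = 1 := by
  obtain ⟨ζ, -, hζ⟩ := Commute.exists_orderOf_eq_lcm Kˣ (Commute.all a b)
  have hpos : 0 < orderOf ζ := by
    rw [hζ]; exact Nat.lcm_pos ha.orderOf_pos hb.orderOf_pos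
  have : NeZero (orderOf ζ) := ⟨hpos.ne'⟩
  have hprim := IsPrimitiveRoot.orderOf ζ
  -- In a field, the roots of unity of order dividing that of `ζ` are powers of `ζ`.
  have hex : ∀ x : Kˣ, orderOf x ∣ orderOf ζ → ∃ i : ℕ, ζ ^ i = x := fun x hx => by
    obtain ⟨i, -, hi⟩ := (hprim.map_of_injective (f := Units.coeHom K)
      Units.val_injective).eq_pow_of_pow_eq_one (ξ := (x : K)) (by
        rw [← Units.val_pow_eq_pow_val, orderOf_dvd_iff_pow_eq_one.1 hx, Units.val_one])
    exact ⟨i, Units.ext (by simpa using hi)⟩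
  obtain ⟨i, hi⟩ := hex a (hζ ▸ Nat.dvd_lcm_left _ _)
  obtain ⟨j, hj⟩ := hex b (hζ ▸ Nat.dvd_lcm_right _ _)
  -- The shift keeps the power of `ζ` and makes the exponent positive, so that the gcd below is
  -- nonzero.
  set i' : ℕ := i + orderOf ζ with hi'
  have ha' : ζ ^ i' = a := by rw [hi', pow_add, pow_orderOf_eq_one, mul_one, hi]
  have hg : 0 < Nat.gcd i' j := Nat.gcd_pos_of_pos_left _ (by omega)
  set g := Nat.gcd i' j with hgdef
  obtain ⟨α, hα⟩ := Nat.gcd_dvd_left i' j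
  obtain ⟨β, hβ⟩ := Nat.gcd_dvd_right i' j
  rw [← hgdef] at hα hβ
  have hbez := Nat.gcd_eq_gcd_ab i' j
  -- The second row `(-j / g, i' / g)` cancels the exponents `i'` and `j`; Bézout coefficients
  -- complete it to determinant one.
  refine ⟨Nat.gcdA i' j, Nat.gcdB i' j, -β, α, ?_, ?_⟩
  · have hg' : (g : ℤ) ≠ 0 := by exact_mod_cast hg.ne'
    apply mul_left_cancel₀ hg'
    have h1 : (i' : ℤ) = g * α := by exact_mod_cast hα
    have h2 : (j : ℤ) = g * β := by exact_mod_cast hβ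
    rw [← hgdef] at hbez
    linear_combination (-1 : ℤ) * hbez - (Nat.gcdA i' j) * h1 - (Nat.gcdB i' j) * h2
  · rw [← ha', ← hj, ← zpow_natCast, ← zpow_natCast, ← zpow_mul, ← zpow_mul, ← zpow_add,
      hα, hβ]
    push_cast
    rw [show (g : ℤ) * α * -β + g * β * α = 0 by ring, zpow_zero]

/-- The dimension of an irreducible representation of a quantum torus in three variables at roots
of unity. -/
theorem finrank_eq_lcm_of_twistedComm {K M : Type*} [Field K] [AddCommGroup M] [Module K M]
    [IsAlgClosed K] [FiniteDimensional K M] [Nontrivial M] {X Y Z : (Module.End K M)ˣ}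
    {a b c : Kˣ} (ha : IsOfFinOrder a) (hb : IsOfFinOrder b) (hc : IsOfFinOrder c)
    (hXY : TwistedComm (scalarUnits K M) X Y a) (hXZ : TwistedComm (scalarUnits K M) X Z b)
    (hYZ : TwistedComm (scalarUnits K M) Y Z c)
    (hirr : IrreducibleUnder {(X : Module.End K M), (Y : Module.End K M), (Z : Module.End K M)}) :
    Module.finrank K M = Nat.lcm (Nat.lcm (orderOf a) (orderOf b)) (orderOf c) := by
  have hcen : ∀ (a : Kˣ) (g : (Module.End K M)ˣ), Commute (scalarUnits K M a) g :=
    scalarUnits_central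
  -- First change, in `Y, Z`: `X` now commutes with `Z₁`, while the scalar `c` between the two new
  -- generators is preserved.
  obtain ⟨p, q, r, s, hdet, hrs⟩ := exists_unimodular_zpow_mul_zpow_eq_one ha hb
  set Y₁ := Y ^ p * Z ^ q with hY₁
  set Z₁ := Y ^ r * Z ^ s with hZ₁
  set d := a ^ p * b ^ q with hd
  have hXY₁ : TwistedComm (scalarUnits K M) X Y₁ d := hXY.monomial_right hcen hXZ p q
  have hXZ₁ : TwistedComm (scalarUnits K M) X Z₁ 1 := hrs ▸ hXY.monomial_right hcen hXZ r s
  have hYZ₁ : TwistedComm (scalarUnits K M) Y₁ Z₁ c := hYZ.unimodular hcen hdet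
  -- By unimodularity together with `a ^ r * b ^ s = 1`, no order is lost: `a` and `b` are powers of
  -- `d`.
  have hds : a = d ^ s := by
    have hbs : b ^ s = a ^ (-r) := by rw [zpow_neg]; exact eq_inv_of_mul_eq_one_right hrs
    rw [hd, mul_zpow, ← zpow_mul, ← zpow_mul, mul_comm q s, zpow_mul b, hbs, ← zpow_mul,
      ← zpow_add, show p * s + -r * q = 1 by linarith, zpow_one]
  have hdr : b = d ^ (-r) := by
    have har : a ^ r = b ^ (-s) := by rw [zpow_neg]; exact eq_inv_of_mul_eq_one_left hrs
    rw [hd, mul_zpow, ← zpow_mul, ← zpow_mul, mul_comm p (-r), neg_mul, ← mul_neg, zpow_mul a, har,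
      ← zpow_mul, ← zpow_add, show -s * -p + q * -r = 1 by linarith, zpow_one]
  have hdfin : IsOfFinOrder d⁻¹ := (ha.zpow.mul hb.zpow).inv
  -- Second change, in the commuting pair `X, Z₁`: `Z₂` now commutes with `Y₁` and still with `X₂`.
  -- The only scalar left is `e`, between `Y₁` and `X₂`.
  obtain ⟨p', q', r', s', hdet', hrs'⟩ := exists_unimodular_zpow_mul_zpow_eq_one hdfin hc
  set X₂ := X ^ p' * Z₁ ^ q' with hX₂
  set Z₂ := X ^ r' * Z₁ ^ s' with hZ₂
  set e := d⁻¹ ^ p' * c ^ q' with he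
  have hYX₂ : TwistedComm (scalarUnits K M) Y₁ X₂ e :=
    (hXY₁.symm).monomial_right hcen hYZ₁ p' q'
  have hYZ₂ : TwistedComm (scalarUnits K M) Y₁ Z₂ 1 :=
    hrs' ▸ (hXY₁.symm).monomial_right hcen hYZ₁ r' s'
  have hXZ₂ : TwistedComm (scalarUnits K M) X₂ Z₂ 1 := hXZ₁.unimodular hcen hdet'
  have hes : d⁻¹ = e ^ s' := by
    have h : c ^ s' = d⁻¹ ^ (-r') := by rw [zpow_neg]; exact eq_inv_of_mul_eq_one_right hrs'
    rw [he, mul_zpow, ← zpow_mul, ← zpow_mul, mul_comm q' s', zpow_mul c, h, ← zpow_mul,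
      ← zpow_add, show p' * s' + -r' * q' = 1 by linarith, zpow_one]
  have her : c = e ^ (-r') := by
    have h : d⁻¹ ^ r' = c ^ (-s') := by rw [zpow_neg]; exact eq_inv_of_mul_eq_one_left hrs'
    rw [he, mul_zpow, ← zpow_mul, ← zpow_mul, mul_comm p' (-r'), neg_mul, ← mul_neg,
      zpow_mul d⁻¹, h, ← zpow_mul, ← zpow_add, show -s' * -p' + q' * -r' = 1 by linarith, zpow_one]
  -- `e` is a monomial in `a, b, c`, and conversely each of `a, b, c` is a power of `e`.
  have heo : orderOf e = Nat.lcm (Nat.lcm (orderOf a) (orderOf b)) (orderOf c) := by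
    apply Nat.dvd_antisymm
    · have hA := orderOf_dvd_iff_pow_eq_one.1
        ((Nat.dvd_lcm_left (orderOf a) (orderOf b)).trans
          (Nat.dvd_lcm_left _ (orderOf c)))
      have hB := orderOf_dvd_iff_pow_eq_one.1
        ((Nat.dvd_lcm_right (orderOf a) (orderOf b)).trans
          (Nat.dvd_lcm_left _ (orderOf c)))
      have hC := orderOf_dvd_iff_pow_eq_one.1
        (Nat.dvd_lcm_right (Nat.lcm (orderOf a) (orderOf b)) (orderOf c))
      generalize Nat.lcm (Nat.lcm (orderOf a) (orderOf b)) (orderOf c) = m at hA hB hC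
      have hz : ∀ (x : Kˣ) (k : ℤ), x ^ m = 1 → (x ^ k) ^ m = 1 := fun x k hx => by
        rw [← zpow_natCast, zpow_comm, zpow_natCast, hx, one_zpow]
      have hD : d⁻¹ ^ m = 1 := by
        rw [inv_pow, hd, mul_pow, hz a p hA, hz b q hB, mul_one, inv_one]
      rw [orderOf_dvd_iff_pow_eq_one, he, mul_pow, hz _ p' hD, hz c q' hC, mul_one]
    · have hde : orderOf d ∣ orderOf e := by
        rw [← orderOf_inv, hes]; exact orderOf_dvd_of_mem_zpowers (Subgroup.zpow_mem_zpowers e s')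
      refine Nat.lcm_dvd (Nat.lcm_dvd ?_ ?_) ?_
      · rw [hds]; exact (orderOf_dvd_of_mem_zpowers (Subgroup.zpow_mem_zpowers d s)).trans hde
      · rw [hdr]; exact (orderOf_dvd_of_mem_zpowers (Subgroup.zpow_mem_zpowers d _)).trans hde
      · rw [her]; exact orderOf_dvd_of_mem_zpowers (Subgroup.zpow_mem_zpowers e _)
  -- Applied to the centralizer of `Z₂` it shows that `Z₂` commutes with `X, Y, Z`; applied to the
  -- stabilizer of a subspace it transfers irreducibility to the pair `Y₁, X₂`.
  have hgen : ∀ H : Subgroup (Module.End K M)ˣ, (∀ a, scalarUnits K M a ∈ H) → X₂ ∈ H → Y₁ ∈ H →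
      Z₂ ∈ H → X ∈ H ∧ Y ∈ H ∧ Z ∈ H := by
    intro H hH hX hY hZ
    obtain ⟨h1, h2⟩ := hXZ₁.mem_of_unimodular hcen hdet' H hH hX hZ
    exact ⟨h1, hYZ.mem_of_unimodular hcen hdet H hH hY h2⟩
  have hcomm : ∀ g : (Module.End K M)ˣ, TwistedComm (scalarUnits K M) g Z₂ 1 →
      g ∈ Subgroup.centralizer {Z₂} := by
    intro g hg
    rw [Subgroup.mem_centralizer_iff]
    rintro _ rfl
    simpa [TwistedComm] using hg.symm
  obtain ⟨hX, hY, hZ⟩ := hgen (Subgroup.centralizer {Z₂})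
    (fun a => Subgroup.mem_centralizer_iff.2 fun g _ => (hcen a g).eq.symm)
    (hcomm _ hXZ₂) (hcomm _ hYZ₂) (hcomm _ (TwistedComm.self _))
  have hval : ∀ g : (Module.End K M)ˣ, g ∈ Subgroup.centralizer {Z₂} →
      (g : Module.End K M) * Z₂ = Z₂ * g := by
    intro g hg
    exact congrArg Units.val (Subgroup.mem_centralizer_iff.1 hg Z₂ rfl).symm
  obtain ⟨ν, hν⟩ := hirr.exists_eq_smul (Z₂ : Module.End K M) (by
    rintro f (rfl | rfl | rfl)
    · exact hval _ hX
    · exact hval _ hY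
    · exact hval _ hZ)
  have hinj : ∀ g : (Module.End K M)ˣ, Function.Injective (g : Module.End K M) := fun g =>
    ((Module.End.isUnit_iff _).1 g.isUnit).injective
  have horder : orderOf (e : K) = orderOf e := orderOf_units
  rw [← heo, ← horder]
  refine finrank_eq_orderOf_of_qcomm (U := (Y₁ : Module.End K M)) (V := (X₂ : Module.End K M))
    ?_ ?_ (hinj _) (hinj _) ?_
  · rw [horder, heo]
    exact Nat.lcm_pos (Nat.lcm_pos ha.orderOf_pos hb.orderOf_pos) hc.orderOf_pos
  · have := congrArg Units.val hYX₂
    ext m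
    exact LinearMap.congr_fun this m
  · intro W hW
    obtain ⟨h1, h2, h3⟩ := hgen (unitsStabilizer W)
      (fun a => scalarUnits_mem_unitsStabilizer a W)
      (hW _ (Or.inr rfl)) (hW _ (Or.inl rfl)) (fun w hw => by rw [hν]; exact W.smul_mem _ hw)
    refine hirr W ?_
    rintro f (rfl | rfl | rfl)
    · exact h1
    · exact h2
    · exact h3

/-! ### Finite-dimensionality via the Nullstellensatz -/

/-- A module that is finite over a finitely generated commutative algebra, whose action commutes
with an irreducible set of operators, is finite-dimensional. -/
theorem finiteDimensional_of_irreducible_of_finite {K M C : Type*} [Field K] [AddCommGroup M]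
    [Module K M] [CommRing C] [Algebra K C] [Algebra.FiniteType K C] [Module C M]
    [IsScalarTower K C M] [Module.Finite C M] [Nontrivial M] {S : Set (Module.End K M)}
    (hirr : IrreducibleUnder S) (hcomm : ∀ f ∈ S, ∀ (c : C) (m : M), f (c • m) = c • f m) :
    FiniteDimensional K M := by
  -- `M` is finite over `C`, so it has a maximal proper submodule `N`, with `M ⧸ N ≅ C ⧸ I` for a
  -- maximal ideal `I`.
  obtain ⟨N, hN, -⟩ := (eq_top_or_exists_le_coatom (⊥ : Submodule C M)).resolve_left bot_ne_top
  have hsimple : IsSimpleModule C (M ⧸ N) := isSimpleModule_iff_isCoatom.2 hN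
  obtain ⟨I, hI, ⟨e⟩⟩ := isSimpleModule_iff_quot_maximal.1 hsimple
  have hIN : I • (⊤ : Submodule C M) ≤ N := by
    rw [Submodule.smul_le]
    intro c hc m _
    rw [← Submodule.Quotient.mk_eq_zero, Submodule.Quotient.mk_smul]
    apply e.injective
    rw [map_smul, map_zero]
    obtain ⟨x, hx⟩ := Ideal.Quotient.mk_surjective (e (Submodule.Quotient.mk m))
    rw [← hx, ← Ideal.Quotient.mk_eq_mk, ← Submodule.Quotient.mk_smul,
      Submodule.Quotient.mk_eq_zero, smul_eq_mul]
    exact I.mul_mem_right x hc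
  -- `I M` is invariant under `S`, whose operators commute with `C`, and it lies in the proper
  -- submodule `N`; hence it vanishes.
  have hbot : (I • (⊤ : Submodule C M)).restrictScalars K = ⊥ := by
    refine (hirr _ ?_).resolve_right fun h => ?_
    · intro f hf w hw
      rw [Submodule.restrictScalars_mem] at hw ⊢
      refine Submodule.smul_induction_on hw (fun c hc m _ => ?_) fun x y hx hy => ?_
      · rw [hcomm f hf]
        exact Submodule.smul_mem_smul hc Submodule.mem_top
      · rw [map_add]; exact add_mem hx hy
    · rw [Submodule.restrictScalars_eq_top_iff] at h
      exact hN.1 (top_le_iff.1 (h ▸ hIN))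
  rw [Submodule.restrictScalars_eq_bot_iff] at hbot
  have htors : Module.IsTorsionBySet C M (I : Set C) := by
    intro m c
    rw [← Submodule.mem_bot C, ← hbot]
    exact Submodule.smul_mem_smul c.2 Submodule.mem_top
  let : Module (C ⧸ I) M := htors.module
  let : Field (C ⧸ I) := Ideal.Quotient.field I
  -- Zariski's lemma: a field finitely generated as a `K`-algebra is finite over `K`.
  have hKC : Module.Finite K (C ⧸ I) := finite_of_finite_type_of_isJacobsonRing K (C ⧸ I)
  have : IsScalarTower C (C ⧸ I) M := htors.isScalarTower
  have : IsScalarTower K (C ⧸ I) M := htors.isScalarTower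
  have : Module.Finite (C ⧸ I) M := Module.Finite.of_restrictScalars_finite C (C ⧸ I) M
  exact Module.Finite.trans (C ⧸ I) M

open scoped IsMulCommutative in
/-- An irreducible representation of the algebra generated by an invertible element `X`, its
inverse up to a scalar `X'`, and elements `Y, Z`, commuting up to roots of unity, is
finite-dimensional. -/
theorem finiteDimensional_of_irreducible_of_qcomm {K M : Type*} [Field K] [AddCommGroup M]
    [Module K M] [Nontrivial M] {X X' Y Z : Module.End K M} {a b c a' b' k : K} {n : ℕ}
    (hn : 0 < n) (ha : a ^ n = 1) (hb : b ^ n = 1) (hc : c ^ n = 1) (ha' : a' ^ n = 1)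
    (hb' : b' ^ n = 1) (hk : k ≠ 0) (hXX' : X * X' = k • 1) (hX'X : X' * X = k • 1)
    (hYX : Y * X = a • (X * Y)) (hZX : Z * X = b • (X * Z)) (hZY : Z * Y = c • (Y * Z))
    (hYX' : Y * X' = a' • (X' * Y)) (hZX' : Z * X' = b' • (X' * Z))
    (hirr : IrreducibleUnder {X, X', Y, Z}) : FiniteDimensional K M := by
  have hcomm : ∀ {x y : Module.End K M} {t : K}, t ^ n = 1 → x * y = t • (y * x) →
      Commute x (y ^ n) ∧ Commute (x ^ n) y := by
    intro x y t ht h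
    have h1 := qcomm_pow_right h n
    have h2 := qcomm_pow_left h n
    rw [ht, one_smul] at h1 h2
    exact ⟨h1, h2⟩
  have hXX'c : Commute X X' := hXX'.trans hX'X.symm
  obtain ⟨cYX, cYX2⟩ := hcomm ha hYX
  obtain ⟨cZX, cZX2⟩ := hcomm hb hZX
  obtain ⟨cZY, cZY2⟩ := hcomm hc hZY
  obtain ⟨cYX', cYX'2⟩ := hcomm ha' hYX'
  obtain ⟨cZX', cZX'2⟩ := hcomm hb' hZX'
  set T : Set (Module.End K M) := {X ^ n, X' ^ n, Y ^ n, Z ^ n} with hT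
  have hST : ∀ f ∈ ({X, X', Y, Z} : Set (Module.End K M)), ∀ t ∈ T, Commute f t := by
    rintro f (rfl | rfl | rfl | rfl) t (rfl | rfl | rfl | rfl)
    exacts [Commute.self_pow _ _, hXX'c.pow_right n, cYX2.symm, cZX2.symm,
      hXX'c.symm.pow_right n, Commute.self_pow _ _, cYX'2.symm, cZX'2.symm,
      cYX, cYX', Commute.self_pow _ _, cZY2.symm, cZX, cZX', cZY, Commute.self_pow _ _]
  have hTT : ∀ s ∈ T, ∀ t ∈ T, s * t = t * s := by
    rintro s (rfl | rfl | rfl | rfl) t ht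
    · exact ((hST X (by simp) t ht).pow_left n).eq
    · exact ((hST X' (by simp) t ht).pow_left n).eq
    · exact ((hST Y (by simp) t ht).pow_left n).eq
    · exact ((hST Z (by simp) t ht).pow_left n).eq
  have : IsMulCommutative (Algebra.adjoin K T) := Algebra.isMulCommutative_adjoin K hTT
  have : Algebra.FiniteType K (Algebra.adjoin K T) :=
    (Algebra.adjoin K T).fg_iff_finiteType.1
      (Subalgebra.fg_def.2 ⟨T, by rw [hT]; exact Set.toFinite _, rfl⟩)
  have hSC : ∀ f ∈ ({X, X', Y, Z} : Set (Module.End K M)), ∀ t : Algebra.adjoin K T,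
      Commute f t := by
    rintro f hf ⟨t, ht⟩
    have : Algebra.adjoin K T ≤ Subalgebra.centralizer K {f} := by
      refine Algebra.adjoin_le fun s hs => ?_
      rw [SetLike.mem_coe, Subalgebra.mem_centralizer_iff]
      rintro _ rfl
      exact (hST _ hf s hs).eq
    exact Subalgebra.mem_centralizer_iff K |>.1 (this ht) f rfl
  have hSC' : ∀ f ∈ ({X, X', Y, Z} : Set (Module.End K M)), ∀ (t : Algebra.adjoin K T) (m : M),
      f (t • m) = t • f m := fun f hf t m => LinearMap.congr_fun (hSC f hf t) m
  have hmem : ∀ t ∈ T, t ∈ Algebra.adjoin K T := fun t ht => Algebra.subset_adjoin ht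
  obtain ⟨v, hv⟩ := exists_ne (0 : M)
  let mon : ℕ → ℕ → ℕ → M := fun i j l => (X ^ i * Y ^ j * Z ^ l) v
  -- Ordered monomials with exponents below `n` suffice, since the `n`-th powers are absorbed into
  -- the coefficients.
  let W : Submodule (Algebra.adjoin K T) M := Submodule.span (Algebra.adjoin K T)
    (Set.range fun i : Fin n × Fin n × Fin n => mon i.1 i.2.1 i.2.2)
  have hmon : ∀ i j l, mon i j l ∈ W := by
    intro i j l
    have e : mon i j l = (⟨X ^ n, hmem _ (by simp [hT])⟩ ^ (i / n) *
        (⟨Y ^ n, hmem _ (by simp [hT])⟩ ^ (j / n) * ⟨Z ^ n, hmem _ (by simp [hT])⟩ ^ (l / n)) :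
        Algebra.adjoin K T) • mon (i % n) (j % n) (l % n) := by
      change (X ^ i * Y ^ j * Z ^ l) v = ((X ^ n) ^ (i / n) * ((Y ^ n) ^ (j / n) *
        (Z ^ n) ^ (l / n)) * (X ^ (i % n) * Y ^ (j % n) * Z ^ (l % n))) v
      congr 1
      conv_lhs => rw [← Nat.div_add_mod i n, ← Nat.div_add_mod j n, ← Nat.div_add_mod l n]
      rw [pow_add, pow_add, pow_add, pow_mul, pow_mul, pow_mul]
      have c1 : Commute (X ^ (i % n)) ((Y ^ n) ^ (j / n)) :=
        (cYX2.symm.pow_pow _ _)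
      have c2 : Commute (X ^ (i % n)) ((Z ^ n) ^ (l / n)) :=
        (cZX2.symm.pow_pow _ _)
      have c3 : Commute (Y ^ (j % n)) ((Z ^ n) ^ (l / n)) :=
        (cZY2.symm.pow_pow _ _)
      generalize (Z ^ n) ^ (l / n) = Z₁ at *
      generalize (Y ^ n) ^ (j / n) = Y₁ at *
      generalize (X ^ n) ^ (i / n) = X₁ at *
      generalize X ^ (i % n) = X₂ at *
      generalize Y ^ (j % n) = Y₂ at *
      generalize Z ^ (l % n) = Z₂ at *
      calc X₁ * X₂ * (Y₁ * Y₂) * (Z₁ * Z₂) = X₁ * (X₂ * Y₁) * (Y₂ * Z₁) * Z₂ := by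
            simp only [mul_assoc]
        _ = X₁ * Y₁ * (X₂ * Z₁) * Y₂ * Z₂ := by rw [c1.eq, c3.eq]; simp only [mul_assoc]
        _ = _ := by rw [c2.eq]; simp only [mul_assoc]
    rw [e]
    exact W.smul_mem _ (Submodule.subset_span
      ⟨(⟨i % n, Nat.mod_lt _ hn⟩, ⟨j % n, Nat.mod_lt _ hn⟩, ⟨l % n, Nat.mod_lt _ hn⟩), rfl⟩)
  have hinv : ∀ f ∈ ({X, X', Y, Z} : Set (Module.End K M)), (∀ i j l, f (mon i j l) ∈ W) →
      ∀ w ∈ W, f w ∈ W := by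
    intro f hf h w hw
    induction hw using Submodule.span_induction with
    | zero => rw [map_zero]; exact zero_mem _
    | add x y _ _ hx hy => rw [map_add]; exact add_mem hx hy
    | smul t x _ hx => rw [hSC' f hf]; exact W.smul_mem _ hx
    | mem x hx =>
      obtain ⟨i, rfl⟩ := hx
      exact h _ _ _
  have hWK : ∀ (t : K) (w : M), w ∈ W → t • w ∈ W := fun t w hw =>
    (W.restrictScalars K).smul_mem t hw
  have hWX : ∀ w ∈ W, X w ∈ W := hinv X (by simp) fun i j l => by
    have : X (mon i j l) = mon (i + 1) j l := by
      simp only [mon, ← Module.End.mul_apply, pow_succ', mul_assoc]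
    rw [this]; exact hmon _ _ _
  have hWY : ∀ w ∈ W, Y w ∈ W := hinv Y (by simp) fun i j l => by
    have : Y (mon i j l) = a ^ i • mon i (j + 1) l := by
      simp only [mon, ← Module.End.mul_apply, ← LinearMap.smul_apply]
      congr 1
      rw [← mul_assoc, ← mul_assoc, qcomm_pow_right hYX i]
      simp only [smul_mul_assoc, pow_succ', mul_assoc]
    rw [this]; exact hWK _ _ (hmon _ _ _)
  have hWZ : ∀ w ∈ W, Z w ∈ W := hinv Z (by simp) fun i j l => by
    have : Z (mon i j l) = (b ^ i * c ^ j) • mon i j (l + 1) := by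
      simp only [mon, ← Module.End.mul_apply, ← LinearMap.smul_apply]
      congr 1
      rw [← mul_assoc, ← mul_assoc, qcomm_pow_right hZX i, smul_mul_assoc, mul_assoc (X ^ i),
        qcomm_pow_right hZY j]
      simp only [smul_mul_assoc, mul_smul_comm, smul_smul, pow_succ', mul_assoc]
    rw [this]; exact hWK _ _ (hmon _ _ _)
  have hWX' : ∀ w ∈ W, X' w ∈ W := by
    intro w hw
    have hpow : ∀ i, (X ^ i) w ∈ W := fun i => by
      induction i with
      | zero => exact hw
      | succ i ih => rw [pow_succ', Module.End.mul_apply]; exact hWX _ ih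
    -- With `i = n - 1`, this writes `X'` as a multiple of `X' ^ n * X ^ (n - 1)`: a coefficient
    -- times powers of `X`, so the monomials need no `X'`.
    have hkey : ∀ i, X' ^ (i + 1) * X ^ i = k ^ i • X' := fun i => by
      induction i with
      | zero => simp
      | succ i ih =>
        rw [pow_succ X', pow_succ' X, mul_assoc, ← mul_assoc X', hX'X, smul_mul_assoc, one_mul,
          mul_smul_comm, ih, smul_smul, pow_succ']
    have h1 : X' w = (k ^ (n - 1))⁻¹ • (X' ^ n) ((X ^ (n - 1)) w) := by
      have := LinearMap.congr_fun (hkey (n - 1)) w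
      rw [Nat.sub_add_cancel hn, Module.End.mul_apply, LinearMap.smul_apply] at this
      rw [this, smul_smul, inv_mul_cancel₀ (pow_ne_zero _ hk), one_smul]
    rw [h1]
    exact hWK _ _ (W.smul_mem (⟨X' ^ n, hmem _ (by simp [hT])⟩ : Algebra.adjoin K T) (hpow _))
  have htop : W = ⊤ := by
    rw [← Submodule.restrictScalars_eq_top_iff K]
    refine (hirr _ ?_).resolve_left fun h => hv ?_
    · rintro f (rfl | rfl | rfl | rfl)
      exacts [hWX, hWX', hWY, hWZ]
    · rw [← Submodule.mem_bot K, ← h, Submodule.restrictScalars_mem]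
      simpa [mon] using hmon 0 0 0
  have : Module.Finite (Algebra.adjoin K T) M := ⟨by
    rw [← htop]; exact Submodule.fg_span (Set.finite_range _)⟩
  exact finiteDimensional_of_irreducible_of_finite (C := Algebra.adjoin K T) hirr hSC'

/-! ### Quotients by one element and their universal property -/

theorem toQuot_surjective {K : Type*} [Field K] {R : Type*} [Ring R] [Algebra K R] (a : R) :
    Function.Surjective (toQuot K a) :=
  RingQuot.mkAlgHom_surjective K _

theorem toQuot_self {K : Type*} [Field K] {R : Type*} [Ring R] [Algebra K R] (a : R) :
    toQuot K a a = 0 := by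
  have := RingQuot.mkAlgHom_rel K (s := fun r s : R => r = a ∧ s = 0) (x := a) (y := 0) ⟨rfl, rfl⟩
  rw [map_zero] at this
  exact this

/-- The map out of `R / ⟨a⟩` induced by a homomorphism killing `a`. -/
def QuotByElem.lift {K : Type*} [Field K] {R S : Type*} [Ring R] [Algebra K R] [Ring S]
    [Algebra K S] {a : R} (f : R →ₐ[K] S) (hf : f a = 0) : QuotByElem a →ₐ[K] S :=
  RingQuot.liftAlgHom K ⟨f, by rintro _ _ ⟨rfl, rfl⟩; rw [hf, map_zero]⟩

theorem QuotByElem.lift_toQuot {K : Type*} [Field K] {R S : Type*} [Ring R] [Algebra K R] [Ring S]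
    [Algebra K S] {a : R} (f : R →ₐ[K] S) (hf : f a = 0) (x : R) :
    QuotByElem.lift f hf (toQuot K a x) = f x :=
  RingQuot.liftAlgHom_mkAlgHom_apply K f _ x

theorem QuotByElem.algHom_ext {K : Type*} [Field K] {R S : Type*} [Ring R] [Algebra K R] [Ring S]
    [Algebra K S] {a : R} {f g : QuotByElem a →ₐ[K] S}
    (h : f.comp (toQuot K a) = g.comp (toQuot K a)) : f = g :=
  RingQuot.ringQuot_ext' K f g h

/-! ### Algebras generated by four elements -/

section Presentations

variable {K : Type*} [Field K] (q₁ q₂ lam : K)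

theorem QWeyl.gen_rel :
    gen q₁ q₂ lam 0 * gen q₁ q₂ lam 2 = (q₁ * lam) • (gen q₁ q₂ lam 2 * gen q₁ q₂ lam 0) ∧
    gen q₁ q₂ lam 0 * gen q₁ q₂ lam 3 = lam⁻¹ • (gen q₁ q₂ lam 3 * gen q₁ q₂ lam 0) ∧
    gen q₁ q₂ lam 1 * gen q₁ q₂ lam 3 = lam • (gen q₁ q₂ lam 3 * gen q₁ q₂ lam 1) ∧
    gen q₁ q₂ lam 1 * gen q₁ q₂ lam 2 = (q₁⁻¹ * lam⁻¹) • (gen q₁ q₂ lam 2 * gen q₁ q₂ lam 1) ∧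
    gen q₁ q₂ lam 0 * gen q₁ q₂ lam 1 - q₁ • (gen q₁ q₂ lam 1 * gen q₁ q₂ lam 0) = 1 ∧
    gen q₁ q₂ lam 2 * gen q₁ q₂ lam 3 - q₂ • (gen q₁ q₂ lam 3 * gen q₁ q₂ lam 2) =
      1 + (q₁ - 1) • (gen q₁ q₂ lam 1 * gen q₁ q₂ lam 0) := by
  have h1 := RingQuot.mkAlgHom_rel K (QWeylRel.x₁x₂ (q₁ := q₁) (q₂ := q₂) (lam := lam))
  have h2 := RingQuot.mkAlgHom_rel K (QWeylRel.x₁y₂ (q₁ := q₁) (q₂ := q₂) (lam := lam))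
  have h3 := RingQuot.mkAlgHom_rel K (QWeylRel.y₁y₂ (q₁ := q₁) (q₂ := q₂) (lam := lam))
  have h4 := RingQuot.mkAlgHom_rel K (QWeylRel.y₁x₂ (q₁ := q₁) (q₂ := q₂) (lam := lam))
  have h5 := RingQuot.mkAlgHom_rel K (QWeylRel.x₁y₁ (q₁ := q₁) (q₂ := q₂) (lam := lam))
  have h6 := RingQuot.mkAlgHom_rel K (QWeylRel.x₂y₂ (q₁ := q₁) (q₂ := q₂) (lam := lam))
  simp only [map_mul, map_smul, map_sub, map_add, map_one] at h1 h2 h3 h4 h5 h6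
  exact ⟨h1, h2, h3, h4, h5, h6⟩

theorem QAffine.gen_rel {n : ℕ} (L : Matrix (Fin n) (Fin n) K) (i j : Fin n) :
    gen L i * gen L j = L i j • (gen L j * gen L i) := by
  have := RingQuot.mkAlgHom_rel K (QAffineRel.comm (L := L) i j)
  simp only [map_mul, map_smul] at this
  exact this

theorem QWeyl.algHom_ext {S : Type*} [Ring S] [Algebra K S] {f g : QWeyl q₁ q₂ lam →ₐ[K] S}
    (h : ∀ i, f (gen q₁ q₂ lam i) = g (gen q₁ q₂ lam i)) : f = g :=
  RingQuot.ringQuot_ext' K f g (FreeAlgebra.hom_ext (funext h))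

theorem QAffine.algHom_ext {n : ℕ} {L : Matrix (Fin n) (Fin n) K} {S : Type*} [Ring S]
    [Algebra K S] {f g : QAffine L →ₐ[K] S} (h : ∀ i, f (gen L i) = g (gen L i)) : f = g :=
  RingQuot.ringQuot_ext' K f g (FreeAlgebra.hom_ext (funext h))

/-- The universal property of the second quantum Weyl algebra. -/
def QWeyl.lift {S : Type*} [Ring S] [Algebra K S] (g : Fin 4 → S)
    (h₁ : g 0 * g 2 = (q₁ * lam) • (g 2 * g 0)) (h₂ : g 0 * g 3 = lam⁻¹ • (g 3 * g 0))
    (h₃ : g 1 * g 3 = lam • (g 3 * g 1)) (h₄ : g 1 * g 2 = (q₁⁻¹ * lam⁻¹) • (g 2 * g 1))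
    (h₅ : g 0 * g 1 - q₁ • (g 1 * g 0) = 1)
    (h₆ : g 2 * g 3 - q₂ • (g 3 * g 2) = 1 + (q₁ - 1) • (g 1 * g 0)) :
    QWeyl q₁ q₂ lam →ₐ[K] S :=
  RingQuot.liftAlgHom K ⟨FreeAlgebra.lift K g, by
    rintro _ _ (_ | _ | _ | _ | _ | _) <;>
    simpa only [map_mul, map_smul, map_sub, map_add, map_one, FreeAlgebra.lift_ι_apply]⟩

theorem QWeyl.lift_gen {S : Type*} [Ring S] [Algebra K S] (g : Fin 4 → S) (h₁ h₂ h₃ h₄ h₅ h₆)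
    (i : Fin 4) : QWeyl.lift q₁ q₂ lam g h₁ h₂ h₃ h₄ h₅ h₆ (gen q₁ q₂ lam i) = g i := by
  unfold QWeyl.lift gen
  rw [RingQuot.liftAlgHom_mkAlgHom_apply, FreeAlgebra.lift_ι_apply]

/-- The universal property of quantum affine space. -/
def QAffine.lift {n : ℕ} {L : Matrix (Fin n) (Fin n) K} {S : Type*} [Ring S] [Algebra K S]
    (g : Fin n → S) (h : ∀ i j, g i * g j = L i j • (g j * g i)) : QAffine L →ₐ[K] S :=
  RingQuot.liftAlgHom K ⟨FreeAlgebra.lift K g, by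
    rintro _ _ ⟨i, j⟩
    simpa only [map_mul, map_smul, FreeAlgebra.lift_ι_apply] using h i j⟩

theorem QAffine.lift_gen {n : ℕ} {L : Matrix (Fin n) (Fin n) K} {S : Type*} [Ring S]
    [Algebra K S] (g : Fin n → S) (h : ∀ i j, g i * g j = L i j • (g j * g i)) (i : Fin n) :
    QAffine.lift g h (gen L i) = g i := by
  unfold QAffine.lift gen
  rw [RingQuot.liftAlgHom_mkAlgHom_apply, FreeAlgebra.lift_ι_apply]

/-- The relation `y₁ x₁ = (1 - q₁)⁻¹` in `B`, without denominators. -/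
theorem TypeIIIQuot.gen_one_mul_gen_zero :
    1 + (q₁ - 1) • (gen q₁ q₂ lam 1 * gen q₁ q₂ lam 0) = 0 := by
  have : toQuot K (typeIIIElem q₁ q₂ lam) (1 + (q₁ - 1) • (QAffine.gen _ 1 * QAffine.gen _ 0)) = 0 :=
    toQuot_self (typeIIIElem q₁ q₂ lam)
  simp only [map_add, map_one, map_smul, map_mul] at this
  exact this

theorem TypeIIIQuot.gen_rel (i j : Fin 4) :
    gen q₁ q₂ lam i * gen q₁ q₂ lam j =
      typeIIIMatrix q₁ q₂ lam i j • (gen q₁ q₂ lam j * gen q₁ q₂ lam i) := by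
  have := congrArg (toQuot K (typeIIIElem q₁ q₂ lam))
    (QAffine.gen_rel (typeIIIMatrix q₁ q₂ lam) i j)
  simp only [map_smul, map_mul] at this
  exact this

/-- In any algebra where `x₁ y₁ - q₁ y₁ x₁ = 1` and `x₁ y₁ = y₁ x₁`, `1 + (q₁ - 1) y₁ x₁ = 0`. -/
theorem one_add_smul_eq_zero {S : Type*} [Ring S] [Algebra K S] {x y : S}
    (h : x * y - q₁ • (y * x) = 1) (hz : x * y - y * x = 0) : 1 + (q₁ - 1) • (y * x) = 0 := by
  rw [sub_eq_zero] at hz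
  rw [← h, hz, sub_smul, one_smul]
  abel

/-- The homomorphism `A → B` sending generators to generators. -/
def QWeyl.toTypeIIIQuot : QWeyl q₁ q₂ lam →ₐ[K] TypeIIIQuot q₁ q₂ lam :=
  QWeyl.lift q₁ q₂ lam (TypeIIIQuot.gen q₁ q₂ lam)
    (by rw [TypeIIIQuot.gen_rel]; rfl) (by rw [TypeIIIQuot.gen_rel]; rfl)
    (by rw [TypeIIIQuot.gen_rel]; rfl) (by rw [TypeIIIQuot.gen_rel]; rfl)
    (by
      have h := TypeIIIQuot.gen_one_mul_gen_zero q₁ q₂ lam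
      have h' : TypeIIIQuot.gen q₁ q₂ lam 0 * TypeIIIQuot.gen q₁ q₂ lam 1 =
          TypeIIIQuot.gen q₁ q₂ lam 1 * TypeIIIQuot.gen q₁ q₂ lam 0 := by
        rw [TypeIIIQuot.gen_rel]
        change (1 : K) • _ = _
        rw [one_smul]
      rw [sub_smul, one_smul] at h
      rw [h', ← sub_eq_zero, ← neg_eq_zero, ← h]
      abel)
    (by
      rw [TypeIIIQuot.gen_one_mul_gen_zero, sub_eq_zero, TypeIIIQuot.gen_rel]
      rfl)

theorem QWeyl.toTypeIIIQuot_gen (i : Fin 4) :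
    QWeyl.toTypeIIIQuot q₁ q₂ lam (gen q₁ q₂ lam i) = TypeIIIQuot.gen q₁ q₂ lam i :=
  QWeyl.lift_gen ..

theorem QWeyl.toTypeIIIQuot_z₁ : QWeyl.toTypeIIIQuot q₁ q₂ lam (z₁ q₁ q₂ lam) = 0 := by
  rw [z₁, map_sub, map_mul, map_mul, toTypeIIIQuot_gen, toTypeIIIQuot_gen, sub_eq_zero,
    TypeIIIQuot.gen_rel]
  exact one_smul K _

variable {q₁ q₂ lam}

/-- Relations satisfied by the classes of the generators modulo `z₁`, or by any elements obeying
the relations of `A` and `x₁ y₁ = y₁ x₁`. -/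
theorem qAffine_rel_of_qWeyl_rel (hq₁ : q₁ ≠ 0) (hq₂ : q₂ ≠ 0) (hlam : lam ≠ 0) {S : Type*}
    [Ring S] [Algebra K S] (g : Fin 4 → S)
    (h₁ : g 0 * g 2 = (q₁ * lam) • (g 2 * g 0)) (h₂ : g 0 * g 3 = lam⁻¹ • (g 3 * g 0))
    (h₃ : g 1 * g 3 = lam • (g 3 * g 1)) (h₄ : g 1 * g 2 = (q₁⁻¹ * lam⁻¹) • (g 2 * g 1))
    (h₅ : g 0 * g 1 = g 1 * g 0) (h₆ : g 2 * g 3 = q₂ • (g 3 * g 2)) (i j : Fin 4) :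
    g i * g j = typeIIIMatrix q₁ q₂ lam i j • (g j * g i) := by
  fin_cases i <;> fin_cases j <;> simp [typeIIIMatrix, h₁, h₂, h₃, h₄, h₅, h₆, smul_smul] <;>
    field_simp <;> simp

/-- The homomorphism `B → A / ⟨z₁⟩` sending generators to generators. -/
def TypeIIIQuot.toQWeylQuot (hq₁ : q₁ ≠ 0) (hq₂ : q₂ ≠ 0) (hlam : lam ≠ 0) :
    TypeIIIQuot q₁ q₂ lam →ₐ[K] QuotByElem (QWeyl.z₁ q₁ q₂ lam) :=
  QuotByElem.lift (QAffine.lift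
    (fun i => toQuot K (QWeyl.z₁ q₁ q₂ lam) (QWeyl.gen q₁ q₂ lam i)) (by
      have hz : toQuot K (QWeyl.z₁ q₁ q₂ lam) (QWeyl.gen q₁ q₂ lam 0 * QWeyl.gen q₁ q₂ lam 1 -
          QWeyl.gen q₁ q₂ lam 1 * QWeyl.gen q₁ q₂ lam 0) = 0 := toQuot_self (QWeyl.z₁ q₁ q₂ lam)
      obtain ⟨h1, h2, h3, h4, h5, h6⟩ := QWeyl.gen_rel q₁ q₂ lam
      have hh := fun x y (h : x = y) => congrArg (toQuot K (QWeyl.z₁ q₁ q₂ lam)) h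
      replace h1 := hh _ _ h1
      replace h2 := hh _ _ h2
      replace h3 := hh _ _ h3
      replace h4 := hh _ _ h4
      replace h5 := hh _ _ h5
      replace h6 := hh _ _ h6
      simp only [map_mul, map_smul, map_sub, map_add, map_one] at h1 h2 h3 h4 h5 h6 hz
      refine qAffine_rel_of_qWeyl_rel hq₁ hq₂ hlam _ h1 h2 h3 h4 (sub_eq_zero.1 hz) ?_
      rw [one_add_smul_eq_zero q₁ h5 hz] at h6
      exact sub_eq_zero.1 h6)) (by
    have hz : toQuot K (QWeyl.z₁ q₁ q₂ lam) (QWeyl.gen q₁ q₂ lam 0 * QWeyl.gen q₁ q₂ lam 1 -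
        QWeyl.gen q₁ q₂ lam 1 * QWeyl.gen q₁ q₂ lam 0) = 0 := toQuot_self (QWeyl.z₁ q₁ q₂ lam)
    have h5 := congrArg (toQuot K (QWeyl.z₁ q₁ q₂ lam)) (QWeyl.gen_rel q₁ q₂ lam).2.2.2.2.1
    simp only [map_mul, map_smul, map_sub, map_one] at h5 hz
    simp only [typeIIIElem, map_add, map_one, map_smul, map_mul, QAffine.lift_gen]
    exact one_add_smul_eq_zero q₁ h5 hz)

theorem TypeIIIQuot.toQWeylQuot_gen (hq₁ : q₁ ≠ 0) (hq₂ : q₂ ≠ 0) (hlam : lam ≠ 0) (i : Fin 4) :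
    toQWeylQuot hq₁ hq₂ hlam (gen q₁ q₂ lam i) =
      toQuot K (QWeyl.z₁ q₁ q₂ lam) (QWeyl.gen q₁ q₂ lam i) := by
  unfold toQWeylQuot gen
  rw [QuotByElem.lift_toQuot, QAffine.lift_gen]

/-- The isomorphism `A / ⟨z₁⟩ ≃ B`. -/
def qWeylQuotEquiv (hq₁ : q₁ ≠ 0) (hq₂ : q₂ ≠ 0) (hlam : lam ≠ 0) :
    QuotByElem (QWeyl.z₁ q₁ q₂ lam) ≃ₐ[K] TypeIIIQuot q₁ q₂ lam :=
  AlgEquiv.ofAlgHom (QuotByElem.lift _ (QWeyl.toTypeIIIQuot_z₁ q₁ q₂ lam))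
    (TypeIIIQuot.toQWeylQuot hq₁ hq₂ hlam)
    (by
      refine QuotByElem.algHom_ext (QAffine.algHom_ext fun i => ?_)
      change QuotByElem.lift _ _ (TypeIIIQuot.toQWeylQuot hq₁ hq₂ hlam (TypeIIIQuot.gen q₁ q₂ lam i))
        = TypeIIIQuot.gen q₁ q₂ lam i
      rw [TypeIIIQuot.toQWeylQuot_gen, QuotByElem.lift_toQuot, QWeyl.toTypeIIIQuot_gen])
    (by
      refine QuotByElem.algHom_ext (QWeyl.algHom_ext _ _ _ fun i => ?_)
      change TypeIIIQuot.toQWeylQuot hq₁ hq₂ hlam (QuotByElem.lift _ _ (toQuot K _ _)) = toQuot K _ _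
      rw [QuotByElem.lift_toQuot, QWeyl.toTypeIIIQuot_gen, TypeIIIQuot.toQWeylQuot_gen])

theorem qWeylQuotEquiv_toQuot (hq₁ : q₁ ≠ 0) (hq₂ : q₂ ≠ 0) (hlam : lam ≠ 0)
    (a : QWeyl q₁ q₂ lam) :
    qWeylQuotEquiv hq₁ hq₂ hlam (toQuot K _ a) = QWeyl.toTypeIIIQuot q₁ q₂ lam a :=
  QuotByElem.lift_toQuot ..

theorem QWeyl.toTypeIIIQuot_surjective (hq₁ : q₁ ≠ 0) (hq₂ : q₂ ≠ 0) (hlam : lam ≠ 0) :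
    Function.Surjective (toTypeIIIQuot q₁ q₂ lam) := fun b => by
  obtain ⟨a, ha⟩ := toQuot_surjective (K := K) (z₁ q₁ q₂ lam)
    ((qWeylQuotEquiv hq₁ hq₂ hlam).symm b)
  exact ⟨a, by rw [← qWeylQuotEquiv_toQuot hq₁ hq₂ hlam, ha, AlgEquiv.apply_symm_apply]⟩

end Presentations

/-! ### Transfer of right modules -/

section Transfer

variable {K A B M : Type*} [Field K] [Ring A] [Algebra K A] [Ring B] [Algebra K B]
  [AddCommGroup M] [Module K M]

/-- The action of an algebra on a right module by `K`-linear operators. -/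
def rightAction (K A M : Type*) [Field K] [Ring A] [Algebra K A] [AddCommGroup M] [Module K M]
    [Module Aᵐᵒᵖ M] [IsScalarTower K Aᵐᵒᵖ M] : A →ₐ[K] (Module.End K M)ᵐᵒᵖ :=
  haveI : SMulCommClass K Aᵐᵒᵖ M := IsScalarTower.to_smulCommClass
  haveI : SMulCommClass Aᵐᵒᵖ K M := SMulCommClass.symm _ _ _
  AlgHom.opComm.symm (Algebra.lsmul K K M)

theorem rightAction_apply [Module Aᵐᵒᵖ M] [IsScalarTower K Aᵐᵒᵖ M] (a : A) (m : M) :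
    (rightAction K A M a).unop m = op a • m := rfl

/-- Along a surjection the two rings act by the same operators, so the submodules coincide; the
identity is a bijective semilinear map. -/
theorem isSimpleModule_iff_of_surjective {R S M : Type*} [Ring R] [Ring S] [AddCommGroup M]
    [Module R M] [Module S M] (f : R →+* S) (hf : Function.Surjective f)
    (h : ∀ (r : R) (m : M), f r • m = r • m) : IsSimpleModule R M ↔ IsSimpleModule S M :=
  haveI : RingHomSurjective f := ⟨hf⟩
  LinearMap.isSimpleModule_iff_of_bijective
    ({ toFun := id, map_add' := fun _ _ => rfl, map_smul' := fun r m => (h r m).symm } :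
      M →ₛₗ[f] M) Function.bijective_id

theorem exists_module_of_factorsThrough [Module Aᵐᵒᵖ M] [IsScalarTower K Aᵐᵒᵖ M]
    (π : A →ₐ[K] B) (ρ : B →ₐ[K] (Module.End K M)ᵐᵒᵖ)
    (hρ : ∀ a, ρ (π a) = rightAction K A M a) :
    ∃ _ : Module Bᵐᵒᵖ M, IsScalarTower K Bᵐᵒᵖ M ∧ ∀ (a : A) (v : M), op (π a) • v = op a • v := by
  let _ : Module Bᵐᵒᵖ M := Module.compHom M (AlgHom.opComm ρ).toRingHom
  have happ : ∀ (b : B) (v : M), op b • v = (ρ b).unop v := fun b v => rfl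
  refine ⟨_, ⟨fun k b v => ?_⟩, fun a v => ?_⟩
  · obtain ⟨b, rfl⟩ := op_surjective b
    rw [← op_smul, happ, happ, map_smul]
    rfl
  · rw [happ, hρ, rightAction_apply]

theorem exists_module_comp [Module Bᵐᵒᵖ M] [IsScalarTower K Bᵐᵒᵖ M] (π : A →ₐ[K] B) :
    ∃ _ : Module Aᵐᵒᵖ M, IsScalarTower K Aᵐᵒᵖ M ∧ ∀ (a : A) (v : M), op a • v = op (π a) • v := by
  let _ : Module Aᵐᵒᵖ M := Module.compHom M (AlgHom.op π).toRingHom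
  have happ : ∀ (a : A) (v : M), op a • v = op (π a) • v := fun b v => rfl
  refine ⟨_, ⟨fun k a v => ?_⟩, happ⟩
  obtain ⟨a, rfl⟩ := op_surjective a
  rw [← op_smul, happ, happ, map_smul, op_smul, smul_assoc]

end Transfer

/-! ### Simple right `A`-modules annihilated by `z₁` -/

/-- An operator that commutes up to non-zero scalars with an irreducible set of operators is zero
or bijective. -/
theorem IrreducibleUnder.eq_zero_or_bijective {K M : Type*} [Field K] [AddCommGroup M] [Module K M]
    {S : Set (Module.End K M)} (hS : IrreducibleUnder S) (T : Module.End K M)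
    (hT : ∀ f ∈ S, ∃ t : K, t ≠ 0 ∧ T * f = t • (f * T)) : T = 0 ∨ Function.Bijective T := by
  have hT' : ∀ f ∈ S, ∃ t : K, t ≠ 0 ∧ ∀ m, T (f m) = t • f (T m) := fun f hf => by
    obtain ⟨t, ht, h⟩ := hT f hf
    exact ⟨t, ht, fun m => LinearMap.congr_fun h m⟩
  -- Kernel and range of `T` are both invariant; it is for the range that the scalar has to be
  -- inverted.
  rcases hS (LinearMap.ker T) fun f hf w hw => by
    obtain ⟨t, -, h⟩ := hT' f hf
    rw [LinearMap.mem_ker] at hw ⊢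
    rw [h, hw, map_zero, smul_zero] with hk | hk
  · rcases hS (LinearMap.range T) fun f hf w hw => by
      obtain ⟨t, ht, h⟩ := hT' f hf
      obtain ⟨m, rfl⟩ := hw
      exact ⟨t⁻¹ • f m, by rw [map_smul, h, smul_smul, inv_mul_cancel₀ ht, one_smul]⟩ with hr | hr
    · exact Or.inl (LinearMap.range_eq_bot.1 hr)
    · exact Or.inr ⟨LinearMap.ker_eq_bot.1 hk, LinearMap.range_eq_top.1 hr⟩
  · exact Or.inl (LinearMap.ker_eq_top.1 hk)

section QWeylModules

variable {K : Type*} [Field K] {q₁ q₂ lam : K} {M : Type*} [AddCommGroup M] [Module K M]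
  [Module (QWeyl q₁ q₂ lam)ᵐᵒᵖ M] [IsScalarTower K (QWeyl q₁ q₂ lam)ᵐᵒᵖ M]

variable (q₁ q₂ lam M) in
/-- The operators by which the generators of `A` act on a right `A`-module. -/
def QWeyl.genEnd (i : Fin 4) : Module.End K M :=
  (rightAction K (QWeyl q₁ q₂ lam) M (gen q₁ q₂ lam i)).unop

theorem QWeyl.actsInvertibly_gen_iff (i : Fin 4) :
    ActsInvertibly M (gen q₁ q₂ lam i) ↔ Function.Bijective (genEnd q₁ q₂ lam M i) := Iff.rfl

theorem QWeyl.actsNilpotently_gen_iff (i : Fin 4) :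
    ActsNilpotently M (gen q₁ q₂ lam i) ↔ IsNilpotent (genEnd q₁ q₂ lam M i) := by
  have h : ∀ (n : ℕ) (v : M), op (gen q₁ q₂ lam i ^ n) • v = (genEnd q₁ q₂ lam M i ^ n) v := by
    intro n v
    rw [← rightAction_apply (K := K), map_pow]
    rfl
  exact exists_congr fun n => by simp only [h, LinearMap.ext_iff, LinearMap.zero_apply]

/-- The operators by which the generators act satisfy the opposite relations. -/
theorem QWeyl.genEnd_rel (hq₁ : q₁ ≠ 1) (hz : ActsAsZero M (z₁ q₁ q₂ lam)) :
    let x := genEnd q₁ q₂ lam M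
    x 2 * x 0 = (q₁ * lam) • (x 0 * x 2) ∧ x 3 * x 0 = lam⁻¹ • (x 0 * x 3) ∧
    x 3 * x 1 = lam • (x 1 * x 3) ∧ x 2 * x 1 = (q₁⁻¹ * lam⁻¹) • (x 1 * x 2) ∧
    x 0 * x 1 = (1 - q₁)⁻¹ • 1 ∧ x 1 * x 0 = (1 - q₁)⁻¹ • 1 ∧ x 3 * x 2 = q₂ • (x 2 * x 3) := by
  intro x
  obtain ⟨h1, h2, h3, h4, h5, h6⟩ := gen_rel q₁ q₂ lam
  have hh := fun a b (h : a = b) => congrArg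
    (fun a => (rightAction K (QWeyl q₁ q₂ lam) M a).unop) h
  have hz' : (rightAction K (QWeyl q₁ q₂ lam) M (z₁ q₁ q₂ lam)).unop = 0 := LinearMap.ext hz
  replace h1 := hh _ _ h1
  replace h2 := hh _ _ h2
  replace h3 := hh _ _ h3
  replace h4 := hh _ _ h4
  replace h5 := hh _ _ h5
  replace h6 := hh _ _ h6
  simp only [z₁, map_mul, map_smul, map_sub, map_add, map_one, unop_mul, unop_smul, unop_sub,
    unop_add, unop_one] at h1 h2 h3 h4 h5 h6 hz'
  change x 1 * x 0 - q₁ • (x 0 * x 1) = 1 at h5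
  change x 1 * x 0 - x 0 * x 1 = 0 at hz'
  change x 3 * x 2 - q₂ • (x 2 * x 3) = 1 + (q₁ - 1) • (x 0 * x 1) at h6
  rw [sub_eq_zero] at hz'
  -- This makes `x 0` and `x 1` inverse up to a scalar, and it also annihilates the right-hand side
  -- of `h6`.
  have h7 : (1 - q₁) • (x 0 * x 1) = 1 := by rw [sub_smul, one_smul, ← h5, hz']
  have h8 : x 0 * x 1 = (1 - q₁)⁻¹ • 1 := by
    rw [← h7, smul_smul, inv_mul_cancel₀ (sub_ne_zero.2 hq₁.symm), one_smul]
  refine ⟨h1, h2, h3, h4, h8, hz'.trans h8, ?_⟩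
  rw [← sub_eq_zero, h6, ← h7, ← add_smul]
  simp

/-- A simple right `A`-module is irreducible under the operators of the generators. -/
theorem QWeyl.irreducibleUnder_genEnd [IsSimpleModule (QWeyl q₁ q₂ lam)ᵐᵒᵖ M] :
    IrreducibleUnder {genEnd q₁ q₂ lam M 0, genEnd q₁ q₂ lam M 1, genEnd q₁ q₂ lam M 2,
      genEnd q₁ q₂ lam M 3} := by
  intro W hW
  have hgen : ∀ i, ∀ w ∈ W, genEnd q₁ q₂ lam M i w ∈ W := by
    intro i
    fin_cases i <;> exact hW _ (by simp)
  have hall : ∀ a : QWeyl q₁ q₂ lam, ∀ w ∈ W,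
      (rightAction K (QWeyl q₁ q₂ lam) M a).unop w ∈ W := by
    intro a
    obtain ⟨f, rfl⟩ := RingQuot.mkAlgHom_surjective K _ a
    induction f using FreeAlgebra.induction with
    | grade0 r =>
      intro w hw
      rw [AlgHom.commutes, AlgHom.commutes]
      exact W.smul_mem r hw
    | grade1 i => exact hgen i
    | mul a b ha hb =>
      intro w hw
      rw [map_mul, map_mul]
      -- On a right module the left factor acts first.
      exact hb _ (ha w hw)
    | add a b ha hb =>
      intro w hw
      rw [map_add, map_add]
      exact W.add_mem (ha w hw) (hb w hw)
  let W' : Submodule (QWeyl q₁ q₂ lam)ᵐᵒᵖ M :=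
    { W with smul_mem' := fun a w hw => hall a.unop w hw }
  rcases eq_bot_or_eq_top W' with h | h
  · left
    ext w
    exact SetLike.ext_iff.1 h w
  · right
    ext w
    exact SetLike.ext_iff.1 h w

/-- The dimensions of the simple right `A`-modules annihilated by `z₁`. -/
theorem QWeyl.finrank_of_isSimpleModule [IsAlgClosed K] {l₁ l₂ l₃ : ℕ} (hl₁ : 0 < l₁)
    (hl₂ : 0 < l₂) (hl₃ : 0 < l₃) (hq₁ : q₁ ≠ 1) (hp₁ : IsPrimitiveRoot q₁ l₁)
    (hp₂ : IsPrimitiveRoot q₂ l₂) (hp₃ : IsPrimitiveRoot lam l₃)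
    [IsSimpleModule (QWeyl q₁ q₂ lam)ᵐᵒᵖ M] (hz : ActsAsZero M (z₁ q₁ q₂ lam)) :
    FiniteDimensional K M ∧
      (ActsInvertibly M (gen q₁ q₂ lam 2) ∨ ActsNilpotently M (gen q₁ q₂ lam 2)) ∧
      (ActsInvertibly M (gen q₁ q₂ lam 3) ∨ ActsNilpotently M (gen q₁ q₂ lam 3)) ∧
      (ActsInvertibly M (gen q₁ q₂ lam 2) → ActsInvertibly M (gen q₁ q₂ lam 3) →
        Module.finrank K M = Nat.lcm (Nat.lcm l₁ l₂) l₃) ∧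
      (ActsInvertibly M (gen q₁ q₂ lam 2) → ActsNilpotently M (gen q₁ q₂ lam 3) →
        Module.finrank K M = orderOf (q₁ * lam)) ∧
      (ActsNilpotently M (gen q₁ q₂ lam 2) → ActsInvertibly M (gen q₁ q₂ lam 3) →
        Module.finrank K M = orderOf lam) ∧
      (ActsNilpotently M (gen q₁ q₂ lam 2) → ActsNilpotently M (gen q₁ q₂ lam 3) →
        Module.finrank K M = 1) := by
  have hnt : Nontrivial M := IsSimpleModule.nontrivial (QWeyl q₁ q₂ lam)ᵐᵒᵖ M
  have hq₁0 : q₁ ≠ 0 := hp₁.ne_zero hl₁.ne'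
  have hq₂0 : q₂ ≠ 0 := hp₂.ne_zero hl₂.ne'
  have hlam0 : lam ≠ 0 := hp₃.ne_zero hl₃.ne'
  simp only [actsInvertibly_gen_iff, actsNilpotently_gen_iff]
  have hirr := irreducibleUnder_genEnd (q₁ := q₁) (q₂ := q₂) (lam := lam) (M := M)
  obtain ⟨h20, h30, h31, h21, h01, h10, h32⟩ := genEnd_rel hq₁ hz
  generalize genEnd q₁ q₂ lam M = x at *
  have hk : (1 - q₁)⁻¹ ≠ 0 := inv_ne_zero (sub_ne_zero.2 hq₁.symm)
  -- A common exponent for all the commutation scalars.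
  set n := l₁ * l₂ * l₃ with hn
  have e₁ : q₁ ^ n = 1 := by rw [hn, mul_assoc, pow_mul, hp₁.pow_eq_one, one_pow]
  have e₂ : q₂ ^ n = 1 := by rw [hn, mul_comm l₁, mul_assoc, pow_mul, hp₂.pow_eq_one, one_pow]
  have e₃ : lam ^ n = 1 := by rw [hn, mul_comm, pow_mul, hp₃.pow_eq_one, one_pow]
  have hfin : FiniteDimensional K M := finiteDimensional_of_irreducible_of_qcomm (n := n)
    (by positivity) (by rw [mul_pow, e₁, e₃, one_mul]) (by rw [inv_pow, e₃, inv_one]) e₂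
    (by rw [mul_pow, inv_pow, inv_pow, e₁, e₃, inv_one, one_mul]) e₃ hk h01 h10 h20 h30 h32 h21 h31
    hirr
  have hx0 : Function.Injective (x 0) := by
    intro u v huv
    have := congrArg (x 1) huv
    rw [← Module.End.mul_apply, ← Module.End.mul_apply, h10] at this
    exact smul_right_injective M hk this
  -- `x 1` is a multiple of the inverse of `x 0`, which preserves the same subspaces in finite
  -- dimension, so `x 1` can be dropped from the irreducible family.
  have h1inv : ∀ W : Submodule K M, (∀ w ∈ W, x 0 w ∈ W) → ∀ w ∈ W, x 1 w ∈ W := by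
    intro W hW w hw
    have hinj : Function.Injective ((x 0).restrict hW) := fun a b h =>
      Subtype.ext (hx0 (congrArg Subtype.val h))
    obtain ⟨u, hu⟩ := LinearMap.injective_iff_surjective.1 hinj ⟨w, hw⟩
    have hu' : x 0 u = w := congrArg Subtype.val hu
    rw [← hu', ← Module.End.mul_apply, h10]
    exact W.smul_mem _ u.2
  have h23 : x 2 * x 3 = q₂⁻¹ • (x 3 * x 2) := by
    rw [h32, smul_smul, inv_mul_cancel₀ hq₂0, one_smul]
  have d2 : x 2 = 0 ∨ Function.Bijective (x 2) := hirr.eq_zero_or_bijective _ (by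
    rintro f (rfl | rfl | rfl | rfl)
    · exact ⟨_, mul_ne_zero hq₁0 hlam0, h20⟩
    · exact ⟨_, mul_ne_zero (inv_ne_zero hq₁0) (inv_ne_zero hlam0), h21⟩
    · exact ⟨1, one_ne_zero, (one_smul _ _).symm⟩
    · exact ⟨_, inv_ne_zero hq₂0, h23⟩)
  have d3 : x 3 = 0 ∨ Function.Bijective (x 3) := hirr.eq_zero_or_bijective _ (by
    rintro f (rfl | rfl | rfl | rfl)
    · exact ⟨_, inv_ne_zero hlam0, h30⟩
    · exact ⟨_, hlam0, h31⟩
    · exact ⟨_, hq₂0, h32⟩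
    · exact ⟨1, one_ne_zero, (one_smul _ _).symm⟩)
  have hnil : ∀ f : Module.End K M, f = 0 ∨ Function.Bijective f → IsNilpotent f → f = 0 := by
    rintro f (h | h) hf
    · exact h
    · exact absurd hf ((Module.End.isUnit_iff f).2 h).not_isNilpotent
  refine ⟨hfin, d2.elim (fun h => Or.inr (h.symm ▸ IsNilpotent.zero)) Or.inl,
    d3.elim (fun h => Or.inr (h.symm ▸ IsNilpotent.zero)) Or.inl, fun b2 b3 => ?_, fun b2 n3 => ?_,
    fun n2 b3 => ?_, fun n2 n3 => ?_⟩
  · let X : (Module.End K M)ˣ := ((Module.End.isUnit_iff (x 0)).2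
      ⟨hx0, LinearMap.injective_iff_surjective.1 hx0⟩).unit
    let Y : (Module.End K M)ˣ := ((Module.End.isUnit_iff (x 2)).2 b2).unit
    let Z : (Module.End K M)ˣ := ((Module.End.isUnit_iff (x 3)).2 b3).unit
    have ho : ∀ u : K, u ^ n = 1 → ∀ hu : u ≠ 0, IsOfFinOrder (Units.mk0 u hu) := fun u hu hu0 =>
      isOfFinOrder_iff_pow_eq_one.2 ⟨n, by positivity, Units.ext (by simpa using hu)⟩
    -- The order `x 3, x 2, x 0` matches the operator relations as they stand, with scalars `q₂`,
    -- `lam⁻¹` and `q₁ * lam`.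
    rw [finrank_eq_lcm_of_twistedComm (X := Z) (Y := Y) (Z := X) (a := Units.mk0 q₂ hq₂0)
      (b := Units.mk0 lam⁻¹ (inv_ne_zero hlam0)) (c := Units.mk0 (q₁ * lam) (mul_ne_zero hq₁0 hlam0))
      (ho _ e₂ _) (ho _ (by rw [inv_pow, e₃, inv_one]) _)
      (ho _ (by rw [mul_pow, e₁, e₃, one_mul]) _)
      (Units.ext (LinearMap.ext fun m => LinearMap.congr_fun h32 m))
      (Units.ext (LinearMap.ext fun m => LinearMap.congr_fun h30 m))
      (Units.ext (LinearMap.ext fun m => LinearMap.congr_fun h20 m)) ?_]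
    · rw [← orderOf_units, ← orderOf_units, ← orderOf_units]
      simp only [Units.val_mk0]
      rw [← hp₂.eq_orderOf, ← hp₃.inv.eq_orderOf]
      have g1 : orderOf (q₁ * lam) ∣ Nat.lcm l₁ l₃ := by
        rw [hp₁.eq_orderOf, hp₃.eq_orderOf]
        exact (Commute.all q₁ lam).orderOf_mul_dvd_lcm
      -- Since `q₁ = (q₁ * lam) * lam⁻¹`, the order of `q₁ * lam` may be exchanged for `l₁` inside
      -- an lcm that contains `l₃`.
      have g2 : l₁ ∣ Nat.lcm (orderOf (q₁ * lam)) l₃ := by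
        have := (Commute.all (q₁ * lam) lam⁻¹).orderOf_mul_dvd_lcm
        rwa [mul_inv_cancel_right₀ hlam0, ← hp₁.eq_orderOf, ← hp₃.inv.eq_orderOf] at this
      generalize orderOf (q₁ * lam) = t at *
      apply Nat.dvd_antisymm
      · refine Nat.lcm_dvd (Nat.lcm_dvd ?_ ?_) (g1.trans (Nat.lcm_dvd ?_ ?_))
        exacts [(Nat.dvd_lcm_right _ _).trans (Nat.dvd_lcm_left _ _), Nat.dvd_lcm_right _ _,
          (Nat.dvd_lcm_left _ _).trans (Nat.dvd_lcm_left _ _), Nat.dvd_lcm_right _ _]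
      · refine Nat.lcm_dvd (Nat.lcm_dvd (g2.trans (Nat.lcm_dvd ?_ ?_)) ?_) ?_
        exacts [Nat.dvd_lcm_right _ _, (Nat.dvd_lcm_right _ _).trans (Nat.dvd_lcm_left _ _),
          (Nat.dvd_lcm_left _ _).trans (Nat.dvd_lcm_left _ _),
          (Nat.dvd_lcm_right _ _).trans (Nat.dvd_lcm_left _ _)]
    · intro W hW
      have w0 := hW (x 0) (Or.inr (Or.inr rfl))
      refine hirr W ?_
      rintro f (rfl | rfl | rfl | rfl)
      exacts [w0, h1inv W w0, hW _ (Or.inr (Or.inl rfl)), hW _ (Or.inl rfl)]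
  · have z3 := hnil _ d3 n3
    refine finrank_eq_orderOf_of_qcomm (orderOf_pos_iff.2 (isOfFinOrder_iff_pow_eq_one.2
      ⟨n, by positivity, by rw [mul_pow, e₁, e₃, one_mul]⟩)) h20 b2.1 hx0 fun W hW => hirr W ?_
    have w0 := hW (x 0) (Or.inr rfl)
    rintro f (rfl | rfl | rfl | rfl)
    exacts [w0, h1inv W w0, hW _ (Or.inl rfl), fun w _ => by rw [z3]; exact W.zero_mem]
  · have z2 := hnil _ d2 n2
    -- The remaining pair `x 3, x 0` has scalar `lam⁻¹`, of the same order as `lam`.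
    rw [← hp₃.eq_orderOf, hp₃.inv.eq_orderOf]
    refine finrank_eq_orderOf_of_qcomm (by rwa [← hp₃.inv.eq_orderOf]) h30 b3.1 hx0
      fun W hW => hirr W ?_
    have w0 := hW (x 0) (Or.inr rfl)
    rintro f (rfl | rfl | rfl | rfl)
    exacts [w0, h1inv W w0, fun w _ => by rw [z2]; exact W.zero_mem, hW _ (Or.inl rfl)]
  · have z2 := hnil _ d2 n2
    have z3 := hnil _ d3 n3
    refine finrank_eq_one_of_irreducible_singleton (U := x 0) (fun W hW => hirr W ?_) hx0
    have w0 := hW (x 0) rfl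
    rintro f (rfl | rfl | rfl | rfl)
    exacts [w0, h1inv W w0, fun w _ => by rw [z2]; exact W.zero_mem,
      fun w _ => by rw [z3]; exact W.zero_mem]

end QWeylModules

/-! ### The main theorem -/

theorem mainTheorem4 {K : Type*} [Field K] [IsAlgClosed K] (q₁ q₂ lam : K) (l₁ l₂ l₃ : ℕ)
    (hl₁ : 0 < l₁) (hl₂ : 0 < l₂) (hl₃ : 0 < l₃) (hq₁ : q₁ ≠ 1) (hq₂ : q₂ ≠ 1)
    (hp₁ : IsPrimitiveRoot q₁ l₁) (hp₂ : IsPrimitiveRoot q₂ l₂) (hp₃ : IsPrimitiveRoot lam l₃) :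
    -- the isomorphism of `A / ⟨z₁⟩` with the quotient of quantum affine space,
    -- and the resulting identification of simple right modules
    (∃ φ : QuotByElem (QWeyl.z₁ q₁ q₂ lam) ≃ₐ[K] TypeIIIQuot q₁ q₂ lam,
      (∀ i, φ (toQuot K (QWeyl.z₁ q₁ q₂ lam) (QWeyl.gen q₁ q₂ lam i)) =
        TypeIIIQuot.gen q₁ q₂ lam i) ∧
      (∀ (M : Type*) [AddCommGroup M] [Module K M] [Module (QWeyl q₁ q₂ lam)ᵐᵒᵖ M]
          [IsScalarTower K (QWeyl q₁ q₂ lam)ᵐᵒᵖ M],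
        IsSimpleModule (QWeyl q₁ q₂ lam)ᵐᵒᵖ M → ActsAsZero M (QWeyl.z₁ q₁ q₂ lam) →
        ∃! inst : Module (TypeIIIQuot q₁ q₂ lam)ᵐᵒᵖ M,
          IsScalarTower K (TypeIIIQuot q₁ q₂ lam)ᵐᵒᵖ M ∧
          (∀ (a : QWeyl q₁ q₂ lam) (v : M),
            op (φ (toQuot K (QWeyl.z₁ q₁ q₂ lam) a)) • v = op a • v) ∧
          IsSimpleModule (TypeIIIQuot q₁ q₂ lam)ᵐᵒᵖ M ∧
          ActsInvertibly M (TypeIIIQuot.gen q₁ q₂ lam 0) ∧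
          ActsInvertibly M (TypeIIIQuot.gen q₁ q₂ lam 1)) ∧
      (∀ (M : Type*) [AddCommGroup M] [Module K M] [Module (TypeIIIQuot q₁ q₂ lam)ᵐᵒᵖ M]
          [IsScalarTower K (TypeIIIQuot q₁ q₂ lam)ᵐᵒᵖ M],
        IsSimpleModule (TypeIIIQuot q₁ q₂ lam)ᵐᵒᵖ M →
        ActsInvertibly M (TypeIIIQuot.gen q₁ q₂ lam 0) →
        ActsInvertibly M (TypeIIIQuot.gen q₁ q₂ lam 1) →
        ∃! inst : Module (QWeyl q₁ q₂ lam)ᵐᵒᵖ M,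
          IsScalarTower K (QWeyl q₁ q₂ lam)ᵐᵒᵖ M ∧
          (∀ (a : QWeyl q₁ q₂ lam) (v : M),
            op a • v = op (φ (toQuot K (QWeyl.z₁ q₁ q₂ lam) a)) • v) ∧
          IsSimpleModule (QWeyl q₁ q₂ lam)ᵐᵒᵖ M ∧
          ActsAsZero M (QWeyl.z₁ q₁ q₂ lam))) ∧
    -- the dimensions of the simple right `A`-modules on which `z₁` acts as zero
    (∀ (M : Type*) [AddCommGroup M] [Module K M] [Module (QWeyl q₁ q₂ lam)ᵐᵒᵖ M]
        [IsScalarTower K (QWeyl q₁ q₂ lam)ᵐᵒᵖ M],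
      IsSimpleModule (QWeyl q₁ q₂ lam)ᵐᵒᵖ M → ActsAsZero M (QWeyl.z₁ q₁ q₂ lam) →
      FiniteDimensional K M ∧
      (ActsInvertibly M (QWeyl.gen q₁ q₂ lam 2) ∨ ActsNilpotently M (QWeyl.gen q₁ q₂ lam 2)) ∧
      (ActsInvertibly M (QWeyl.gen q₁ q₂ lam 3) ∨ ActsNilpotently M (QWeyl.gen q₁ q₂ lam 3)) ∧
      (ActsInvertibly M (QWeyl.gen q₁ q₂ lam 2) → ActsInvertibly M (QWeyl.gen q₁ q₂ lam 3) →
        Module.finrank K M = Nat.lcm (Nat.lcm l₁ l₂) l₃) ∧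
      (ActsInvertibly M (QWeyl.gen q₁ q₂ lam 2) → ActsNilpotently M (QWeyl.gen q₁ q₂ lam 3) →
        Module.finrank K M = orderOf (q₁ * lam)) ∧
      (ActsNilpotently M (QWeyl.gen q₁ q₂ lam 2) → ActsInvertibly M (QWeyl.gen q₁ q₂ lam 3) →
        Module.finrank K M = orderOf lam) ∧
      (ActsNilpotently M (QWeyl.gen q₁ q₂ lam 2) → ActsNilpotently M (QWeyl.gen q₁ q₂ lam 3) →
        Module.finrank K M = 1)) := by
  have hq₁0 : q₁ ≠ 0 := hp₁.ne_zero hl₁.ne'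
  have hq₂0 : q₂ ≠ 0 := hp₂.ne_zero hl₂.ne'
  have hlam0 : lam ≠ 0 := hp₃.ne_zero hl₃.ne'
  refine ⟨⟨qWeylQuotEquiv hq₁0 hq₂0 hlam0, fun i => ?_, ?_, ?_⟩, ?_⟩
  · rw [qWeylQuotEquiv_toQuot, QWeyl.toTypeIIIQuot_gen]
  · intro M _ _ _ _ hsimple hz
    have hsurj : Function.Surjective (QWeyl.toTypeIIIQuot q₁ q₂ lam) :=
      QWeyl.toTypeIIIQuot_surjective hq₁0 hq₂0 hlam0
    -- The action of `A` kills `z₁`, hence factors through `A / ⟨z₁⟩`, and the inverse isomorphism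
    -- carries it to `B`.
    obtain ⟨inst, htower, hinst⟩ := exists_module_of_factorsThrough (K := K) (M := M)
      (QWeyl.toTypeIIIQuot q₁ q₂ lam)
      ((QuotByElem.lift (rightAction K (QWeyl q₁ q₂ lam) M)
        (unop_injective (LinearMap.ext hz))).comp
        (qWeylQuotEquiv hq₁0 hq₂0 hlam0).symm.toAlgHom) (fun a => by
          rw [← qWeylQuotEquiv_toQuot hq₁0 hq₂0 hlam0]
          change QuotByElem.lift _ _ ((qWeylQuotEquiv hq₁0 hq₂0 hlam0).symm _) = _
          rw [AlgEquiv.symm_apply_apply, QuotByElem.lift_toQuot])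
    simp only [qWeylQuotEquiv_toQuot]
    have hx0x1 := (QWeyl.genEnd_rel (M := M) hq₁ hz).2.2.2.2
    have hbij : ∀ x y : Module.End K M, x * y = (1 - q₁)⁻¹ • 1 → y * x = (1 - q₁)⁻¹ • 1 →
        Function.Bijective x := by
      intro x y hxy hyx
      have hk : 1 - q₁ ≠ 0 := sub_ne_zero.2 hq₁.symm
      refine (Module.End.isUnit_iff x).1 ⟨⟨x, (1 - q₁) • y, ?_, ?_⟩, rfl⟩
      · rw [mul_smul_comm, hxy, smul_smul, mul_inv_cancel₀ hk, one_smul]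
      · rw [smul_mul_assoc, hyx, smul_smul, mul_inv_cancel₀ hk, one_smul]
    have hact : ∀ i, ActsInvertibly M (QWeyl.gen q₁ q₂ lam i) →
        ActsInvertibly M (TypeIIIQuot.gen q₁ q₂ lam i) := by
      intro i hi
      unfold ActsInvertibly
      simp only [← QWeyl.toTypeIIIQuot_gen, hinst]
      exact hi
    refine ⟨inst, ⟨htower, hinst, ?_, hact 0 ?_, hact 1 ?_⟩, ?_⟩
    · exact (isSimpleModule_iff_of_surjective
        (AlgHom.op (QWeyl.toTypeIIIQuot q₁ q₂ lam)).toRingHom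
        (fun b => by
          obtain ⟨a, ha⟩ := hsurj b.unop
          exact ⟨op a, unop_injective ha⟩) (fun a v => hinst a.unop v)).1 hsimple
    · exact hbij _ _ hx0x1.1 hx0x1.2.1
    · exact hbij _ _ hx0x1.2.1 hx0x1.1
    · rintro inst' ⟨-, hinst', -⟩
      refine Module.ext' _ _ fun b v => ?_
      obtain ⟨b, rfl⟩ := op_surjective b
      obtain ⟨a, rfl⟩ := hsurj b
      exact (hinst' a v).trans (hinst a v).symm
  · intro M _ _ _ _ hsimple _ _
    have hsurj : Function.Surjective (QWeyl.toTypeIIIQuot q₁ q₂ lam) :=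
      QWeyl.toTypeIIIQuot_surjective hq₁0 hq₂0 hlam0
    obtain ⟨inst, htower, hinst⟩ := exists_module_comp (K := K) (M := M)
      (QWeyl.toTypeIIIQuot q₁ q₂ lam)
    simp only [qWeylQuotEquiv_toQuot]
    refine ⟨inst, ⟨htower, hinst, ?_, fun v => ?_⟩, ?_⟩
    · exact (isSimpleModule_iff_of_surjective
        (AlgHom.op (QWeyl.toTypeIIIQuot q₁ q₂ lam)).toRingHom
        (fun b => by
          obtain ⟨a, ha⟩ := hsurj b.unop
          exact ⟨op a, unop_injective ha⟩) (fun a v => (hinst a.unop v).symm)).2 hsimple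
    · rw [hinst, QWeyl.toTypeIIIQuot_z₁, op_zero, zero_smul]
    · rintro inst' ⟨-, hinst', -⟩
      refine Module.ext' _ _ fun a v => ?_
      obtain ⟨a, rfl⟩ := op_surjective a
      exact (hinst' a v).trans (hinst a v).symm
  · intro M _ _ _ _ _ hz
    exact QWeyl.finrank_of_isSimpleModule hl₁ hl₂ hl₃ hq₁ hp₁ hp₂ hp₃ hz
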